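/- For $\tau\in\mathbb H=\{\tau\in\mathbb C:\operatorname{Im}\tau>0\}$ and $\operatorname{Re}s>0$ put $$G_2(s,\tau)=\frac12\sum_{(m,n)\in\mathbb Z^2\setminus\{(0,0)\}}\frac{1}{(m\tau+n)^2}\,\frac{\operatorname{Im}(\tau)^s}{|m\tau+n|^{2s}},\qquad G_2^*(\tau)=\lim_{s\to0,\ \operatorname{Re}s>0}G_2(s,\tau),$$ $$G_{2,N}(\tau)=N\,G_2^*(N\tau)-G_2^*(\tau)\quad(N\ge1),\qquad \theta_4(\tau)=\sum_{n\in\mathbb Z}(-1)^n e^{\pi i n^2\tau}.$$ Let $\tau_7=\frac{1+\sqrt{-7}}2$, $\tau_8=\sqrt{-2}$, $\tau_{12}=\sqrt{-3}$, $\tau_{16}=2i$, $\tau_{27}=\frac{1+\sqrt{-27}}2$, $\zeta_3=e^{2\pi i/3}$ (square roots of negative numbers being taken in $\mathbb H$), and for $D\in\{7,8,12,16,27\}$ let $f_D$ be the CM cusp form of weight $3$ and level $D$ $$f_D=\frac12\sum_{m,n\in\mathbb Z}(m+n\overline{\tau_D})^2\,q^{|m+n\tau_D|^2}.$$ For $f=\sum_{n\ge1}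 a_nq^n$ and a Dirichlet character $\chi$ write $f\otimes\chi=\sum_{n\ge1} a_n\chi(n)q^n$, let $\chi_\ell=\left(\frac{\ell}{\cdot}\right)$ be the Kronecker symbol, and let $$f_{32}=f_8\otimes\chi_{-4},\quad f_{48}=f_{12}\otimes\chi_{-4},\quad f_{112}=f_7\otimes\chi_{-4},\quad f_{64}=f_{16}\otimes\chi_{-8},\quad f_{144}=f_{16}\otimes\chi_{-3},$$ which are CM forms of weight $3$ and levels $32,48,112,64,144$. For each of these forms let $L(f,2)$ denote the value at $s=2$ of the analytic continuation of $L(f,s)=\sum_{n\ge1}a_nn^{-s}$ (absolutely convergent for $\operatorname{Re}s$ large). Then the limit defining $G_2^*(\tau)$ exists for every $\tau\in\mathbb H$, the Dirichlet series $L(f,s)$ of $f_{27},f_{32},f_{48},f_{64},f_{112},f_{144}$ continue holomorphically to an open half-plane containing $s=2$, and \begin{align*} L(f_{27},2)&=\tfrac13\,G_{2,3}(\zeta_3),\\ L(f_{32},2)&=\tfrac{\pi^2}8\,\theta_4(\sqrt{-2})^4,\\ L(f_{48},2)&=\tfrac{\pi^2}8\,\theta_4(2\zeta_3)^4,\\ L(f_{64},2)&=\tfrac{\pi^2}8\,\theta_4(2i)^4,\\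 L(f_{112},2)&=\tfrac14\,G_{2,4}\!\left(\tfrac{\sqrt{-7}}2\right)=\tfrac{\pi^2}8\,\theta_4(1+\sqrt{-7})^4,\\ L(f_{144},2)&=-\tfrac23\,G_{2,2}(i)+G_{2,2}(3i)+\tfrac19\,G_{2,2}\!\left(\tfrac i3\right)=\tfrac{4}{3\sqrt3}\,G_{2,2}(i). \end{align*} -/

import Mathlib

open Complex Filter Topology

noncomputable section

namespace CMForms

/-- The filter of complex numbers `s → 0` with `Re s > 0`. -/
def rightOfZero : Filter ℂ := 𝓝[{s : ℂ | 0 < s.re}] 0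

/-- The non-holomorphic Eisenstein series
`G_k(s, τ) = (1/2) ∑_{(m,n) ≠ (0,0)} (mτ + n)^{-k} Im(τ)^s / |mτ + n|^{2s}`
(absolutely convergent for `Im τ > 0` and `Re (2s + k) > 2`). -/
def eisensteinG (k : ℕ) (s τ : ℂ) : ℂ :=
  (1 / 2) * ∑' p : {p : ℤ × ℤ // p ≠ (0, 0)},
    1 / ((p.1.1 : ℂ) * τ + (p.1.2 : ℂ)) ^ k *
      (((τ.im : ℝ) : ℂ) ^ s / ((‖(p.1.1 : ℂ) * τ + (p.1.2 : ℂ)‖ : ℝ) : ℂ) ^ (2 * s))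

/-- `G_2^*(τ)`, the limit of `G_2(s, τ)` as `s → 0` with `Re s > 0`. -/
def G2star (τ : ℂ) : ℂ := limUnder rightOfZero (fun s => eisensteinG 2 s τ)

/-- `G_{2,N}(τ) = N G_2^*(Nτ) - G_2^*(τ)`. -/
def G2level (N : ℕ) (τ : ℂ) : ℂ := (N : ℂ) * G2star ((N : ℂ) * τ) - G2star τ

/-- The Jacobi theta function `θ_4(τ) = ∑_{n ∈ ℤ} (-1)^n q^{n²/2}`, `q = exp(2πiτ)`. -/
def theta4 (τ : ℂ) : ℂ :=
  ∑' n : ℤ, (-1 : ℂ) ^ n * cexp (2 * (Real.pi : ℂ) * I * τ * ((n : ℂ) ^ 2 / 2))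

/-- The `n`-th coefficient of the theta series
`(1/2) ∑_{m,k ∈ ℤ} (m + k \bar τ)² q^{|m + kτ|²}`; for `Im τ ≠ 0` the sum is finite. -/
def thetaCoeff (τ : ℂ) (n : ℕ) : ℂ :=
  (1 / 2) * ∑' p : {p : ℤ × ℤ // normSq ((p.1 : ℂ) + (p.2 : ℂ) * τ) = (n : ℝ)},
    ((p.1.1 : ℂ) + (p.1.2 : ℂ) * (starRingEnd ℂ) τ) ^ 2

/-- Coefficients of the twist `f ⊗ χ` of `f = ∑ a_n q^n` by a Dirichlet character `χ`. -/
def twist {N : ℕ} (a : ℕ → ℂ) (χ : DirichletCharacter ℂ N) (n : ℕ) : ℂ := a n * χ (n : ZMod N)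

/-- The Dirichlet character `(-4 / ·)`, modulo `4`. -/
def chiNeg4 : DirichletCharacter ℂ 4 := ZMod.χ₄.ringHomComp (Int.castRingHom ℂ)

/-- The Dirichlet character `(-8 / ·)`, modulo `8`. -/
def chiNeg8 : DirichletCharacter ℂ 8 := ZMod.χ₈'.ringHomComp (Int.castRingHom ℂ)

/-- The Dirichlet character `(-3 / ·)`, modulo `3`; it is the quadratic character modulo `3`. -/
def chiNeg3 : DirichletCharacter ℂ 3 :=
  (quadraticChar (ZMod 3)).ringHomComp (Int.castRingHom ℂ)

/-- `τ_7 = (1 + √-7) / 2`. -/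
def tau7 : ℂ := (1 + I * (√7 : ℝ)) / 2
/-- `τ_8 = √-2`. -/
def tau8 : ℂ := I * (√2 : ℝ)
/-- `τ_12 = √-3`. -/
def tau12 : ℂ := I * (√3 : ℝ)
/-- `τ_16 = √-4 = 2i`. -/
def tau16 : ℂ := 2 * I
/-- `τ_27 = (1 + √-27) / 2`. -/
def tau27 : ℂ := (1 + I * (√27 : ℝ)) / 2

/-! Fourier coefficients of the weight `3` CM forms of level `27`, `32`, `48`, `64`, `112`, `144`:
a CM theta series, or the twist of one. -/

/-- Coefficients of the form of level `27`. -/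
def f27 : ℕ → ℂ := thetaCoeff tau27
/-- Coefficients of the form of level `32`: `f_8 ⊗ χ_{-4}`. -/
def f32 : ℕ → ℂ := twist (thetaCoeff tau8) chiNeg4
/-- Coefficients of the form of level `48`: `f_12 ⊗ χ_{-4}`. -/
def f48 : ℕ → ℂ := twist (thetaCoeff tau12) chiNeg4
/-- Coefficients of the form of level `64`: `f_16 ⊗ χ_{-8}`. -/
def f64 : ℕ → ℂ := twist (thetaCoeff tau16) chiNeg8
/-- Coefficients of the form of level `112`: `f_7 ⊗ χ_{-4}`. -/
def f112 : ℕ → ℂ := twist (thetaCoeff tau7) chiNeg4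
/-- Coefficients of the form of level `144`: `f_16 ⊗ χ_{-3}`. -/
def f144 : ℕ → ℂ := twist (thetaCoeff tau16) chiNeg3

/-- `HasLValue a s₀ v`: the `L`-function of `f = ∑ a_n q^n` takes the value `v` at `s₀`. That is,
`∑ a_n n^{-s}` converges absolutely for `Re s` large, and continues holomorphically to an open
half-plane containing `s₀`, with value `v` at `s₀`. -/
def HasLValue (a : ℕ → ℂ) (s₀ v : ℂ) : Prop :=
  ∃ (σ σ' : ℝ) (L : ℂ → ℂ), σ < s₀.re ∧ DifferentiableOn ℂ L {s : ℂ | σ < s.re} ∧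
    (∀ s : ℂ, σ' < s.re → LSeriesSummable a s ∧ L s = LSeries a s) ∧ L s₀ = v

/-- The value of the `L`-function at a point is unique. -/
theorem HasLValue.unique {a : ℕ → ℂ} {s₀ v w : ℂ} (hv : HasLValue a s₀ v)
    (hw : HasLValue a s₀ w) : v = w := by
  obtain ⟨σ, σ', L, h1, h2, h3, rfl⟩ := hv
  obtain ⟨ρ, ρ', M, k1, k2, k3, rfl⟩ := hw
  have hopen (r : ℝ) : IsOpen {s : ℂ | r < s.re} := isOpen_lt continuous_const continuous_re
  set U : Set ℂ := {s : ℂ | max σ ρ < s.re} with hU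
  have hL : AnalyticOnNhd ℂ L U := (h2.mono fun s hs =>
    lt_of_le_of_lt (le_max_left σ ρ) hs).analyticOnNhd (hopen _)
  have hM : AnalyticOnNhd ℂ M U := (k2.mono fun s hs =>
    lt_of_le_of_lt (le_max_right σ ρ) hs).analyticOnNhd (hopen _)
  have hconn : IsPreconnected U := (convex_halfSpace_re_gt _).isPreconnected
  let r : ℝ := max (max σ ρ) (max σ' ρ') + 1
  have hr1 : max σ ρ < r := lt_of_le_of_lt (le_max_left _ (max σ' ρ')) (lt_add_one _)
  have hr2 : max σ' ρ' < r := lt_of_le_of_lt (le_max_right (max σ ρ) _) (lt_add_one _)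
  have hz : (r : ℂ) ∈ U := by simpa [hU] using hr1
  have hev : L =ᶠ[𝓝 (r : ℂ)] M := by
    filter_upwards [(hopen (max σ' ρ')).mem_nhds (show max σ' ρ' < (r : ℂ).re by simpa using hr2)]
      with s hs
    rw [(h3 s (lt_of_le_of_lt (le_max_left _ _) hs)).2,
      (k3 s (lt_of_le_of_lt (le_max_right _ _) hs)).2]
  exact hL.eqOn_of_preconnected_of_eventuallyEq hM hconn hz hev (max_lt h1 k1)

/-- `ζ_3 = exp(2πi/3)`. -/
def zeta3 : ℂ := cexp (2 * (Real.pi : ℂ) * I / 3)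

end CMForms

end

open Complex Filter Topology

noncomputable section

namespace CMForms

/-! ### The summand of the non-holomorphic Eisenstein series -/

/-! Since `z̄² |z|^{-2s} = z⁻² |z|^{-2(s-2)}`, the L-series of a CM theta series or of its twist is
half a lattice sum of `kernel (s - 2)` with periodic weights, so its value at `2` is a weight 2
Eisenstein value at Hecke parameter `0`. Splitting modulo `N` gives a combination of series
`shiftedSum s τ a` at torsion points `a` (`tsum_weight_kernel`). Subtracting the unshifted series
gains one power of decay: `regSum` is holomorphic for `Re s > -1/2` and equals `℘(a)` at `s = 0`.
When the weights sum to zero only `regSum` remains, which yields both the continuation and the value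
(`hasLValue_of_weight`).

Write `e₁, e₂, e₃` for `℘` at `1/2`, `τ/2`, `(1+τ)/2`. The duplication formula expresses `(1 -
4^{-s}) shiftedSum s τ 0` through `regSum` at the half-periods, so the limit defining `G_2^*` exists
once `e₁ + e₂ + e₃ = 0`. This is `halfPeriodSum_eq_zero`, deduced from the behaviour of the sum
under `τ ↦ τ + 1` and `τ ↦ 2τ`.

For levels 32, 48, 64, 112 the character of the norm becomes `(-1)^m` on odd `n`, for a suitable
lattice, and the L-value is `(e₁ - e₃)/8`. Jacobi's identity `e₁ - e₃ = π² θ₄⁴`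
(`regSum_zero_sub_eq_theta4`) holds because the product of three conjugates of the difference of its
sides, squared, is a level one form of weight 12 that decays too fast (`eq_zero_of_thetaGroup`).

For level 27 the lattice is `3ℤζ₃ + ℤ`, and `G_2^*(ζ₃) = 0` by symmetry. For level 144 the weights
modulo 3 give values of `G_2^*` at `6i`, `2i/3`, `2i`; these are values of `℘` at torsion points of
`ℤ[i]`, related by half-period translation (`exists_weierstrassP_half_period_mul`) and duplication,
and `√3` enters through the quadratic equation for `℘(1/3)²`. -/

/-- `z ↦ z⁻² |z|^{-2s}`, with value `0` at `0`. -/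
def kernel (s z : ℂ) : ℂ := (z ^ 2)⁻¹ * cexp (-s * (Real.log (normSq z) : ℝ))

@[simp] lemma kernel_zero_right (s : ℂ) : kernel s 0 = 0 := by simp [kernel]

lemma kernel_zero_left (z : ℂ) : kernel 0 z = (z ^ 2)⁻¹ := by simp [kernel]

lemma kernel_mul (s c z : ℂ) : kernel s (c * z) = kernel s c * kernel s z := by
  rcases eq_or_ne c 0 with rfl | hc
  · simp
  rcases eq_or_ne z 0 with rfl | hz
  · simp
  have h1 : normSq c ≠ 0 := by simpa using hc
  have h2 : normSq z ≠ 0 := by simpa using hz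
  simp only [kernel, map_mul, Real.log_mul h1 h2, ofReal_add, mul_add, Complex.exp_add, mul_pow,
    mul_inv]
  ring

@[simp] lemma kernel_neg (s z : ℂ) : kernel s (-z) = kernel s z := by simp [kernel]

lemma differentiable_kernel (z : ℂ) : Differentiable ℂ fun s => kernel s z := by
  unfold kernel
  fun_prop

lemma tendsto_kernel (z : ℂ) : Tendsto (fun s => kernel s z) rightOfZero (𝓝 (z ^ 2)⁻¹) := by
  have h := (differentiable_kernel z).continuous.tendsto 0
  rw [kernel_zero_left] at h
  exact h.mono_left nhdsWithin_le_nhds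

lemma norm_kernel {z : ℂ} (hz : z ≠ 0) (s : ℂ) : ‖kernel s z‖ = ‖z‖ ^ (-(2 + 2 * s.re)) := by
  have h0 : 0 < ‖z‖ := norm_pos_iff.mpr hz
  rw [kernel, norm_mul, norm_inv, norm_pow, Complex.norm_exp, re_mul_ofReal, neg_re,
    normSq_eq_norm_sq, Real.log_pow, Real.rpow_def_of_pos h0, ← Real.exp_log h0, ← Real.exp_nat_mul,
    ← Real.exp_neg, ← Real.exp_add, Real.log_exp]
  congr 1
  push_cast
  ring

lemma kernel_add {z a : ℂ} (hz : z ≠ 0) (h : 1 + a / z ≠ 0) (s : ℂ) :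
    kernel s (z + a) =
      kernel s z * cexp (-2 * log (1 + a / z) - 2 * s * ((log (1 + a / z)).re : ℝ)) := by
  have e : z + a = z * (1 + a / z) := by field_simp
  rw [e, kernel_mul]
  congr 1
  rw [kernel, Complex.log_re, normSq_eq_norm_sq, Real.log_pow, sub_eq_add_neg, Complex.exp_add]
  congr 1
  · rw [neg_mul, Complex.exp_neg, two_mul, Complex.exp_add, Complex.exp_log h, pow_two]
  · congr 1
    push_cast
    ring

/-- By `kernel_add` the shift is a factor `exp w` with `|w| ≤ 3(1 + ‖s‖)‖a/z‖ ≤ 1`, and then `|exp w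
- 1| ≤ 2|w|`. The gain of one power of `‖z‖` is the source of all convergence at `s = 0`. -/
lemma norm_kernel_add_sub_le {z a s : ℂ} (hz : z ≠ 0) (h1 : ‖a / z‖ ≤ 1 / 2)
    (h2 : 3 * (1 + ‖s‖) * ‖a / z‖ ≤ 1) :
    ‖kernel s (z + a) - kernel s z‖ ≤
      6 * (1 + ‖s‖) * ‖a‖ * ‖z‖ ^ (-(3 + 2 * s.re)) := by
  have h0 : 0 < ‖z‖ := norm_pos_iff.mpr hz
  have hne : 1 + a / z ≠ 0 := by
    intro h
    have : a / z = -1 := by linear_combination h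
    rw [this] at h1
    norm_num at h1
  have hlog := norm_log_one_add_half_le_self h1
  set u := log (1 + a / z)
  have hb : ‖-2 * u - 2 * s * (u.re : ℝ)‖ ≤ 3 * (1 + ‖s‖) * ‖a / z‖ := by
    calc ‖-2 * u - 2 * s * (u.re : ℝ)‖ ≤ ‖-2 * u‖ + ‖2 * s * (u.re : ℝ)‖ := norm_sub_le _ _
      _ = 2 * ‖u‖ + 2 * ‖s‖ * |u.re| := by simp
      _ ≤ 2 * ‖u‖ + 2 * ‖s‖ * ‖u‖ := by gcongr; exact abs_re_le_norm u
      _ = 2 * (1 + ‖s‖) * ‖u‖ := by ring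
      _ ≤ 2 * (1 + ‖s‖) * (3 / 2 * ‖a / z‖) := by gcongr
      _ = _ := by ring
  have hexp := Complex.norm_exp_sub_one_le (hb.trans h2)
  rw [kernel_add hz hne, ← mul_sub_one, norm_mul, norm_kernel hz]
  calc ‖z‖ ^ (-(2 + 2 * s.re)) * ‖cexp (-2 * u - 2 * s * (u.re : ℝ)) - 1‖
      ≤ ‖z‖ ^ (-(2 + 2 * s.re)) * (2 * (3 * (1 + ‖s‖) * ‖a / z‖)) := by
        gcongr
        exact hexp.trans (by gcongr)
    _ = 6 * (1 + ‖s‖) * ‖a‖ * (‖z‖ ^ (-(2 + 2 * s.re)) * ‖z‖ ^ (-1 : ℝ)) := by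
        rw [norm_div, Real.rpow_neg_one]
        ring
    _ = _ := by
        rw [← Real.rpow_add h0]
        ring_nf

/-! ### Sums over a lattice `ℤτ + ℤ` -/

/-- The lattice point `mτ + n`. -/
def point (τ : ℂ) (p : ℤ × ℤ) : ℂ := p.1 * τ + p.2

@[simp] lemma point_zero (τ : ℂ) : point τ 0 = 0 := by simp [point]

lemma norm_int_prod (p : ℤ × ℤ) : ‖![p.1, p.2]‖ = ‖p‖ := by
  simp [EisensteinSeries.norm_eq_max_natAbs, Prod.norm_def, Int.norm_eq_abs]

lemma summable_norm_int_prod {k : ℝ} (hk : 2 < k) :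
    Summable fun p : ℤ × ℤ => ‖p‖ ^ (-k) := by
  have h := EisensteinSeries.summable_one_div_norm_rpow hk
  rw [← (finTwoArrowEquiv ℤ).symm.summable_iff] at h
  refine h.congr fun p => ?_
  rw [← norm_int_prod]
  simp

lemma tendsto_norm_int_prod : Tendsto (fun p : ℤ × ℤ => ‖p‖) cofinite atTop := by
  rw [← cocompact_eq_cofinite (X := ℤ × ℤ)]
  exact tendsto_norm_cocompact_atTop

/-- Uniformity over the strip serves both holomorphy in `τ` and the limits at `i∞`. -/
lemma exists_le_norm_point_of_strip (A : ℝ) {B : ℝ} (hB : 0 < B) :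
    ∃ c > 0, ∀ τ : ℂ, |τ.re| ≤ A → B ≤ τ.im → ∀ p, c * ‖p‖ ≤ ‖point τ p‖ := by
  refine ⟨EisensteinSeries.r ⟨⟨A, B⟩, hB⟩, EisensteinSeries.r_pos _, fun τ hA hB' p => ?_⟩
  rcases eq_or_ne p 0 with rfl | hp
  · simp
  have hx : ![p.1, p.2] ≠ 0 := by
    rw [← norm_ne_zero_iff, norm_int_prod]
    simpa using hp
  have h1 := EisensteinSeries.r_mul_max_le ⟨τ, hB.trans_le hB'⟩ hx
  have h2 := EisensteinSeries.r_lower_bound_on_verticalStrip ⟨τ, hB.trans_le hB'⟩ hB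
    (show _ ∈ UpperHalfPlane.verticalStrip A B from ⟨hA, hB'⟩)
  rw [norm_int_prod] at h1
  refine (mul_le_mul_of_nonneg_right h2 (norm_nonneg p)).trans (h1.trans_eq ?_)
  simp [point]

lemma exists_le_norm_point {τ : ℂ} (hτ : 0 < τ.im) :
    ∃ c > 0, ∀ p, c * ‖p‖ ≤ ‖point τ p‖ := by
  obtain ⟨c, hc, h⟩ := exists_le_norm_point_of_strip |τ.re| hτ
  exact ⟨c, hc, h τ le_rfl le_rfl⟩

lemma tendsto_norm_point {τ : ℂ} (hτ : 0 < τ.im) :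
    Tendsto (fun p => ‖point τ p‖) cofinite atTop := by
  obtain ⟨c, hc, h⟩ := exists_le_norm_point hτ
  exact tendsto_atTop_mono h (tendsto_norm_int_prod.const_mul_atTop hc)

lemma summable_kernel {τ : ℂ} (hτ : 0 < τ.im) (a : ℂ) {s : ℂ} (hs : 0 < s.re) :
    Summable fun p => kernel s (point τ p + a) := by
  obtain ⟨c, hc, h⟩ := exists_le_norm_point hτ
  refine Summable.of_norm_bounded_eventually (E := ℂ)
    (g := fun p : ℤ × ℤ => (c / 2) ^ (-(2 + 2 * s.re)) * ‖p‖ ^ (-(2 + 2 * s.re)))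
    ((summable_norm_int_prod (by linarith)).mul_left _) ?_
  filter_upwards [(tendsto_norm_point hτ).eventually_ge_atTop (2 * ‖a‖ + 1),
    tendsto_norm_int_prod.eventually_gt_atTop 0] with p hp hp0
  have h1 : c / 2 * ‖p‖ ≤ ‖point τ p + a‖ := by
    have := norm_sub_le (point τ p + a) a
    rw [add_sub_cancel_right] at this
    linarith [h p]
  have h2 : 0 < ‖point τ p + a‖ := lt_of_lt_of_le (by positivity) h1
  rw [norm_kernel (norm_pos_iff.mp h2), ← Real.mul_rpow (by positivity) (by positivity)]
  exact Real.rpow_le_rpow_of_nonpos (by positivity) h1 (by linarith)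

/-- The shifted Eisenstein series `∑ kernel s (mτ + n + a)`. -/
def shiftedSum (s τ a : ℂ) : ℂ := ∑' p : ℤ × ℤ, kernel s (point τ p + a)

/-- The regularised shifted Eisenstein series; at `s = 0` it is the Weierstrass `℘`-function. -/
def regSum (s τ a : ℂ) : ℂ := ∑' p : ℤ × ℤ, (kernel s (point τ p + a) - kernel s (point τ p))

lemma regSum_eq {τ : ℂ} (hτ : 0 < τ.im) (a : ℂ) {s : ℂ} (hs : 0 < s.re) :
    regSum s τ a = shiftedSum s τ a - shiftedSum s τ 0 := by
  have h0 := summable_kernel hτ 0 hs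
  simp only [add_zero] at h0
  rw [regSum, (summable_kernel hτ a hs).tsum_sub h0]
  simp [shiftedSum]

/-- The exponent `3 + 2 Re s` is at least `2 + 2ε`, enough for summability over a rank 2 lattice,
uniformly for bounded `s`. -/
lemma eventually_norm_kernel_sub_le {τ : ℂ} (hτ : 0 < τ.im) (a : ℂ) {ε R : ℝ} (hε : 0 < ε) :
    ∃ C : ℝ, ∀ᶠ p in cofinite, ∀ s : ℂ, -(1 / 2) + ε ≤ s.re → ‖s‖ ≤ R →
      ‖kernel s (point τ p + a) - kernel s (point τ p)‖ ≤ C * ‖p‖ ^ (-(2 + 2 * ε)) := by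
  obtain ⟨c, hc, h⟩ := exists_le_norm_point hτ
  refine ⟨6 * (1 + R) * ‖a‖ * c ^ (-(2 + 2 * ε)), ?_⟩
  filter_upwards [(tendsto_norm_point hτ).eventually_ge_atTop (2 * ‖a‖ + 3 * (1 + R) * ‖a‖ + 1),
    (tendsto_norm_point hτ).eventually_ge_atTop 1,
    (tendsto_norm_point hτ).eventually_ge_atTop (2 * ‖a‖),
    (tendsto_norm_point hτ).eventually_ge_atTop (3 * (1 + R) * ‖a‖),
    tendsto_norm_int_prod.eventually_gt_atTop 0] with p hp hp1 hp2 hp3 hp0 s hs hsR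
  have h0 : 0 < ‖point τ p‖ := by linarith
  have hR : 0 ≤ R := (norm_nonneg s).trans hsR
  have := norm_kernel_add_sub_le (z := point τ p) (a := a) (s := s) (norm_pos_iff.mp h0)
    (by rw [norm_div, div_le_iff₀ h0]; linarith)
    (by
      rw [norm_div, ← mul_div_assoc, div_le_iff₀ h0, one_mul]
      refine le_trans ?_ hp3
      gcongr)
  refine this.trans ?_
  calc 6 * (1 + ‖s‖) * ‖a‖ * ‖point τ p‖ ^ (-(3 + 2 * s.re))
      ≤ 6 * (1 + R) * ‖a‖ * ‖point τ p‖ ^ (-(2 + 2 * ε)) := by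
        have := Real.rpow_le_rpow_of_exponent_le hp1
          (show -(3 + 2 * s.re) ≤ -(2 + 2 * ε) by linarith)
        gcongr
    _ ≤ 6 * (1 + R) * ‖a‖ * (c ^ (-(2 + 2 * ε)) * ‖p‖ ^ (-(2 + 2 * ε))) := by
        gcongr
        rw [← Real.mul_rpow hc.le hp0.le]
        exact Real.rpow_le_rpow_of_nonpos (by positivity) (h p) (by linarith)
    _ = _ := by ring

lemma summable_kernel_sub {τ : ℂ} (hτ : 0 < τ.im) (a : ℂ) {s : ℂ} (hs : -(1 / 2) < s.re) :
    Summable fun p => kernel s (point τ p + a) - kernel s (point τ p) := by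
  have hε : 0 < s.re + 1 / 2 := by linarith
  obtain ⟨C, hC⟩ := eventually_norm_kernel_sub_le hτ a (R := ‖s‖) hε
  refine Summable.of_norm_bounded_eventually (E := ℂ)
    ((summable_norm_int_prod (k := 2 + 2 * (s.re + 1 / 2)) (by linarith)).mul_left C) ?_
  filter_upwards [hC] with p hp
  exact hp s (by linarith) le_rfl

lemma differentiableOn_regSum {τ : ℂ} (hτ : 0 < τ.im) (a : ℂ) :
    DifferentiableOn ℂ (fun s => regSum s τ a) {s | -(1 / 2) < s.re} := by
  intro s hs
  simp only [Set.mem_ofPred_eq] at hs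
  have hε : 0 < (s.re + 1 / 2) / 2 := by linarith
  set ε := (s.re + 1 / 2) / 2 with hεdef
  obtain ⟨C, hC⟩ := eventually_norm_kernel_sub_le hτ a (R := ‖s‖ + 1) hε
  set U : Set ℂ := {w | -(1 / 2) + ε < w.re} ∩ {w | ‖w‖ < ‖s‖ + 1}
  have hU : IsOpen U :=
    (isOpen_lt continuous_const continuous_re).inter (isOpen_lt continuous_norm continuous_const)
  have hT : TendstoUniformlyOn (fun (t : Finset (ℤ × ℤ)) w =>
      ∑ p ∈ t, (kernel w (point τ p + a) - kernel w (point τ p)))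
      (fun w => regSum w τ a) atTop U := by
    refine tendstoUniformlyOn_tsum_of_cofinite_eventually
      ((summable_norm_int_prod (k := 2 + 2 * ε) (by linarith)).mul_left C) ?_
    filter_upwards [hC] with p hp w hw
    exact hp w hw.1.le hw.2.le
  have hD : DifferentiableOn ℂ (fun w => regSum w τ a) U := by
    refine hT.tendstoLocallyUniformlyOn.differentiableOn (Eventually.of_forall fun t => ?_) hU
    refine Differentiable.differentiableOn ?_
    exact Differentiable.fun_sum fun p _ =>
      (differentiable_kernel _).sub (differentiable_kernel _)
  refine (hD.differentiableAt (hU.mem_nhds ⟨?_, ?_⟩)).differentiableWithinAt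
  · simp only [Set.mem_ofPred_eq]; linarith
  · simp

instance : rightOfZero.NeBot := by
  rw [rightOfZero, ← mem_closure_iff_nhdsWithin_neBot, Complex.closure_setOfPred_lt_re]
  simp

lemma eventually_rightOfZero : ∀ᶠ s : ℂ in rightOfZero, 0 < s.re :=
  eventually_mem_nhdsWithin

lemma tendsto_regSum {τ : ℂ} (hτ : 0 < τ.im) (a : ℂ) :
    Tendsto (fun s => regSum s τ a) rightOfZero (𝓝 (regSum 0 τ a)) := by
  have h := (differentiableOn_regSum hτ a).continuousOn.continuousAt (x := 0)
    ((isOpen_lt continuous_const continuous_re).mem_nhds (by norm_num))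
  exact h.tendsto.mono_left nhdsWithin_le_nhds

lemma tendsto_shiftedSum_sub {τ : ℂ} (hτ : 0 < τ.im) (a : ℂ) :
    Tendsto (fun s => shiftedSum s τ a - shiftedSum s τ 0) rightOfZero (𝓝 (regSum 0 τ a)) :=
  (tendsto_regSum hτ a).congr' <| eventually_rightOfZero.mono fun _ hs => regSum_eq hτ a hs

/-! ### Change of lattice -/

lemma Summable.tsum_int_prod_residues {f : ℤ × ℤ → ℂ} (hf : Summable f) (N : ℕ) [NeZero N] :
    ∑' p, f p = ∑ r : Fin N × Fin N,
      ∑' q : ℤ × ℤ, f (q.1 * N + (r.1 : ℕ), q.2 * N + (r.2 : ℕ)) := by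
  let e : (ℤ × ℤ) × (Fin N × Fin N) ≃ ℤ × ℤ :=
    (Equiv.prodProdProdComm ℤ ℤ (Fin N) (Fin N)).trans
      (Equiv.prodCongr (Int.divModEquiv N).symm (Int.divModEquiv N).symm)
  have he : Summable (f ∘ e) := e.summable_iff.mpr hf
  rw [← e.tsum_eq f]
  have h2 : Summable ((f ∘ e) ∘ (Equiv.prodComm (Fin N × Fin N) (ℤ × ℤ))) :=
    (Equiv.summable_iff _).mpr he
  rw [← (Equiv.prodComm (Fin N × Fin N) (ℤ × ℤ)).tsum_eq]
  exact h2.tsum_prod.trans (tsum_fintype _)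

/-- With `p = Nq + r`, the argument is `N` times `point τ q + (point τ r + b)/N`, and `N` factors
out by multiplicativity of `kernel`. -/
lemma tsum_weight_kernel {τ : ℂ} (hτ : 0 < τ.im) (N : ℕ) [NeZero N] (w : ℤ × ℤ → ℂ)
    (hw : ∀ q r : ℤ × ℤ, w (q.1 * N + r.1, q.2 * N + r.2) = w r) (b : ℂ) {s : ℂ} (hs : 0 < s.re) :
    ∑' p, w p * kernel s (point τ p + b) = kernel s N * ∑ r : Fin N × Fin N,
      w ((r.1 : ℕ), (r.2 : ℕ)) * shiftedSum s τ ((point τ ((r.1 : ℕ), (r.2 : ℕ)) + b) / N) := by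
  have hN : (N : ℂ) ≠ 0 := NeZero.ne _
  -- A periodic weight takes finitely many values, hence does not affect summability.
  have hbd : ∃ C : ℝ, ∀ p, ‖w p‖ ≤ C := by
    refine ⟨∑ r : Fin N × Fin N, ‖w ((r.1 : ℕ), (r.2 : ℕ))‖, fun p => ?_⟩
    let r : Fin N × Fin N := ((Int.divModEquiv N p.1).2, (Int.divModEquiv N p.2).2)
    have e1 := (Int.divModEquiv N).symm_apply_apply p.1
    have e2 := (Int.divModEquiv N).symm_apply_apply p.2
    have : w p = w ((r.1 : ℕ), (r.2 : ℕ)) := by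
      rw [← hw ((Int.divModEquiv N p.1).1, (Int.divModEquiv N p.2).1) ((r.1 : ℕ), (r.2 : ℕ))]
      congr 1
      exact Prod.ext e1.symm e2.symm
    rw [this]
    exact Finset.single_le_sum (f := fun r : Fin N × Fin N => ‖w ((r.1 : ℕ), (r.2 : ℕ))‖)
      (fun _ _ => norm_nonneg _) (Finset.mem_univ r)
  obtain ⟨C, hC⟩ := hbd
  have hsum : Summable fun p => w p * kernel s (point τ p + b) := by
    refine Summable.of_norm_bounded ((summable_kernel hτ b hs).norm.mul_left C) fun p => ?_
    rw [norm_mul]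
    gcongr
    exact hC p
  rw [Summable.tsum_int_prod_residues hsum N, Finset.mul_sum]
  refine Finset.sum_congr rfl fun r _ => ?_
  rw [shiftedSum, ← tsum_mul_left, ← tsum_mul_left]
  refine tsum_congr fun q => ?_
  have e := hw q ((r.1 : ℕ), (r.2 : ℕ))
  simp only at e
  rw [e, mul_left_comm, ← kernel_mul]
  congr 2
  simp only [point]
  push_cast
  field_simp
  ring

lemma shiftedSum_add_point (s τ a : ℂ) (q : ℤ × ℤ) :
    shiftedSum s τ (a + point τ q) = shiftedSum s τ a := by
  rw [shiftedSum, ← (Equiv.addRight (-q)).tsum_eq]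
  refine tsum_congr fun p => ?_
  congr 1
  simp only [point, Equiv.coe_addRight, Prod.fst_add, Prod.snd_add, Prod.fst_neg, Prod.snd_neg]
  push_cast
  ring

lemma shiftedSum_congr {s τ a b : ℂ} (m n : ℤ) (h : b = a + (m * τ + n)) :
    shiftedSum s τ b = shiftedSum s τ a := by
  rw [h]
  exact shiftedSum_add_point s τ a (m, n)

lemma shiftedSum_neg (s τ a : ℂ) : shiftedSum s τ (-a) = shiftedSum s τ a := by
  rw [shiftedSum, ← (Equiv.neg (ℤ × ℤ)).tsum_eq]
  refine tsum_congr fun p => ?_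
  rw [← kernel_neg]
  congr 1
  simp only [point, Equiv.neg_apply, Prod.fst_neg, Prod.snd_neg]
  push_cast
  ring

/-- Shear of `ℤ × ℤ`. -/
def shearEquiv (k : ℤ) : ℤ × ℤ ≃ ℤ × ℤ where
  toFun p := (p.1, p.2 + k * p.1)
  invFun p := (p.1, p.2 - k * p.1)
  left_inv p := by simp
  right_inv p := by simp

lemma point_shearEquiv (τ : ℂ) (k : ℤ) (p : ℤ × ℤ) :
    point τ (shearEquiv k p) = point (τ + k) p := by
  simp [point, shearEquiv]
  ring

lemma shiftedSum_add_int (s τ a : ℂ) (k : ℤ) :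
    shiftedSum s (τ + k) a = shiftedSum s τ a := by
  rw [shiftedSum, shiftedSum, ← (shearEquiv k).tsum_eq fun p => kernel s (point τ p + a)]
  simp only [point_shearEquiv]

/-- Reindexing of `m(-1/τ) + n + a = τ⁻¹ (nτ - m + τa)`. -/
lemma shiftedSum_neg_inv (s : ℂ) {τ : ℂ} (hτ : τ ≠ 0) (a : ℂ) :
    shiftedSum s (-1 / τ) a = kernel s τ⁻¹ * shiftedSum s τ (τ * a) := by
  let e : ℤ × ℤ ≃ ℤ × ℤ := (Equiv.prodComm ℤ ℤ).trans ((Equiv.refl ℤ).prodCongr (Equiv.neg ℤ))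
  rw [shiftedSum, shiftedSum, ← e.tsum_eq (fun p => kernel s (point τ p + τ * a)),
    ← tsum_mul_left]
  refine tsum_congr fun p => ?_
  rw [← kernel_mul]
  congr 1
  simp [point, e]
  field_simp
  ring

lemma tsum_dvd_fst (f : ℤ × ℤ → ℂ) (N : ℕ) [NeZero N] :
    ∑' p : ℤ × ℤ, (if (N : ℤ) ∣ p.1 then 1 else 0) * f p = ∑' p : ℤ × ℤ, f (N * p.1, p.2) := by
  have hN : (N : ℤ) ≠ 0 := NeZero.ne _
  have hi : Function.Injective fun p : ℤ × ℤ => ((N : ℤ) * p.1, p.2) := by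
    rintro ⟨a, b⟩ ⟨c, d⟩ h
    simp only [Prod.mk.injEq, mul_right_inj' hN] at h
    exact Prod.ext h.1 h.2
  rw [← hi.tsum_eq]
  · simp
  · intro p hp
    have : (N : ℤ) ∣ p.1 := by
      by_contra h
      simp [h] at hp
    obtain ⟨k, hk⟩ := this
    exact ⟨(k, p.2), Prod.ext hk.symm rfl⟩

lemma tsum_dvd_snd (f : ℤ × ℤ → ℂ) (N : ℕ) [NeZero N] :
    ∑' p : ℤ × ℤ, (if (N : ℤ) ∣ p.2 then 1 else 0) * f p = ∑' p : ℤ × ℤ, f (p.1, N * p.2) := by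
  rw [← (Equiv.prodComm ℤ ℤ).tsum_eq, ← (Equiv.prodComm ℤ ℤ).tsum_eq (fun p => f (p.1, N * p.2))]
  exact tsum_dvd_fst (fun p => f p.swap) N

/-- The lattice `ℤNτ + ℤ` is the part of `ℤτ + ℤ` with `N ∣ m`, so only the residues with first
entry `0` survive. -/
lemma shiftedSum_nat_mul (N : ℕ) [NeZero N] {τ : ℂ} (hτ : 0 < τ.im) (a : ℂ) {s : ℂ}
    (hs : 0 < s.re) :
    shiftedSum s (N * τ) a = kernel s N * ∑ j : Fin N, shiftedSum s τ (((j : ℕ) + a) / N) := by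
  have h1 : shiftedSum s (N * τ) a =
      ∑' p : ℤ × ℤ, (if (N : ℤ) ∣ p.1 then 1 else 0) * kernel s (point τ p + a) := by
    rw [tsum_dvd_fst, shiftedSum]
    refine tsum_congr fun p => ?_
    congr 1
    simp [point]
    ring
  rw [h1, tsum_weight_kernel hτ N _ (fun q r => by simp) a hs, Fintype.sum_prod_type,
    Finset.sum_eq_single (0 : Fin N)]
  · simp [point]
  · intro i _ hi
    have : ¬ (N : ℤ) ∣ ((i : ℕ) : ℤ) := by
      rw [Int.natCast_dvd_natCast]
      exact fun h => hi (Fin.ext (by simpa using Nat.eq_zero_of_dvd_of_lt h i.2))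
    simp [this]
  · simp

/-- Scaled by `N`, the lattice `ℤτ/N + ℤ` is the part of `ℤτ + ℤ` with `N ∣ n`; the common factor
`kernel s N` cancels. -/
lemma shiftedSum_div_nat (N : ℕ) [NeZero N] {τ : ℂ} (hτ : 0 < τ.im) (a : ℂ) {s : ℂ}
    (hs : 0 < s.re) :
    shiftedSum s (τ / N) a = ∑ j : Fin N, shiftedSum s τ (a + (j : ℕ) * τ / N) := by
  have hN : (N : ℂ) ≠ 0 := NeZero.ne _
  have h1 : kernel s N * shiftedSum s (τ / N) a =
      ∑' p : ℤ × ℤ, (if (N : ℤ) ∣ p.2 then 1 else 0) * kernel s (point τ p + N * a) := by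
    rw [tsum_dvd_snd, shiftedSum, ← tsum_mul_left]
    refine tsum_congr fun p => ?_
    rw [← kernel_mul]
    congr 1
    simp [point]
    field_simp
  have hk : kernel s N ≠ 0 := by simp [kernel, hN, Complex.exp_ne_zero]
  apply mul_left_cancel₀ hk
  rw [h1, tsum_weight_kernel hτ N _ (fun q r => by simp) _ hs, Fintype.sum_prod_type]
  congr 1
  refine Finset.sum_congr rfl fun i _ => ?_
  rw [Finset.sum_eq_single (0 : Fin N)]
  · simp [point]
    congr 1
    field_simp
    ring
  · intro i _ hi
    have : ¬ (N : ℤ) ∣ ((i : ℕ) : ℤ) := by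
      rw [Int.natCast_dvd_natCast]
      exact fun h => hi (Fin.ext (by simpa using Nat.eq_zero_of_dvd_of_lt h i.2))
    simp [this]
  · simp

/-- The distribution relation for multiplication by `2`. -/
lemma shiftedSum_two_mul {τ : ℂ} (hτ : 0 < τ.im) (a : ℂ) {s : ℂ} (hs : 0 < s.re) :
    shiftedSum s τ (2 * a) = kernel s 2 * (shiftedSum s τ a + shiftedSum s τ (a + 1 / 2) +
      shiftedSum s τ (a + τ / 2) + shiftedSum s τ (a + (1 + τ) / 2)) := by
  have h := tsum_weight_kernel hτ 2 1 (fun _ _ => rfl) (2 * a) hs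
  simp only [Pi.one_apply, one_mul, Nat.cast_ofNat, Fintype.sum_prod_type, Fin.sum_univ_two] at h
  rw [shiftedSum, h]
  simp only [point]
  norm_num
  left
  ring_nf

/-- The factor `1 - 4 * kernel s 2 = 1 - 4^{-s}` has a simple zero at `s = 0`, so the limit of the
unshifted series hinges on the vanishing of the right-hand side there. -/
lemma shiftedSum_zero_mul {τ : ℂ} (hτ : 0 < τ.im) {s : ℂ} (hs : 0 < s.re) :
    (1 - 4 * kernel s 2) * shiftedSum s τ 0 =
      kernel s 2 * (regSum s τ (1 / 2) + regSum s τ (τ / 2) + regSum s τ ((1 + τ) / 2)) := by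
  have h := shiftedSum_two_mul hτ 0 hs
  rw [regSum_eq hτ _ hs, regSum_eq hτ _ hs, regSum_eq hτ _ hs]
  simp only [mul_zero, zero_add] at h
  linear_combination h

/-! ### The regularised sum at `s = 0` -/

/-- At `s = 0` the separate series are not absolutely convergent, so identities for `℘` are proved
for `Re s > 0` and passed to the limit, where non-holomorphic factors disappear. -/
lemma regSum_zero_congr {τ τ' a a' c : ℂ} (hτ : 0 < τ.im) (hτ' : 0 < τ'.im) {u : ℂ → ℂ}
    (hu : Tendsto u rightOfZero (𝓝 c))
    (h : ∀ s : ℂ, 0 < s.re → shiftedSum s τ' a' - shiftedSum s τ' 0 =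
      u s * (shiftedSum s τ a - shiftedSum s τ 0)) :
    regSum 0 τ' a' = c * regSum 0 τ a :=
  tendsto_nhds_unique (tendsto_shiftedSum_sub hτ' a') <|
    (hu.mul (tendsto_shiftedSum_sub hτ a)).congr' <|
      eventually_rightOfZero.mono fun s hs => (h s hs).symm

lemma regSum_zero_shift {τ a b : ℂ} (hτ : 0 < τ.im) (m n : ℤ) (h : b = a + (m * τ + n)) :
    regSum 0 τ b = regSum 0 τ a := by
  rw [regSum_zero_congr hτ hτ (a := a) tendsto_const_nhds (c := 1), one_mul]
  intro s _
  rw [shiftedSum_congr m n h, one_mul]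

lemma regSum_zero_neg {τ : ℂ} (hτ : 0 < τ.im) (a : ℂ) : regSum 0 τ (-a) = regSum 0 τ a := by
  rw [regSum_zero_congr hτ hτ (a := a) tendsto_const_nhds (c := 1), one_mul]
  intro s _
  rw [shiftedSum_neg, one_mul]

lemma regSum_zero_add_int {τ : ℂ} (hτ : 0 < τ.im) (a : ℂ) (k : ℤ) :
    regSum 0 (τ + k) a = regSum 0 τ a := by
  rw [regSum_zero_congr hτ (by simpa using hτ) (a := a) tendsto_const_nhds (c := 1), one_mul]
  intro s _
  rw [shiftedSum_add_int, shiftedSum_add_int, one_mul]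

lemma im_neg_one_div_pos {τ : ℂ} (hτ : 0 < τ.im) : 0 < (-1 / τ).im := by
  have h0 : τ ≠ 0 := by rintro rfl; simp at hτ
  rw [neg_div, one_div, neg_im, inv_im, neg_div, neg_neg]
  exact div_pos hτ (normSq_pos.mpr h0)

lemma ne_zero_of_im_pos {τ : ℂ} (hτ : 0 < τ.im) : τ ≠ 0 := by
  rintro rfl
  simp at hτ

lemma regSum_zero_neg_inv {τ : ℂ} (hτ : 0 < τ.im) (a : ℂ) :
    regSum 0 (-1 / τ) a = τ ^ 2 * regSum 0 τ (τ * a) := by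
  have h := tendsto_kernel τ⁻¹
  rw [inv_pow, inv_inv] at h
  refine regSum_zero_congr hτ (im_neg_one_div_pos hτ) h fun s _ => ?_
  rw [shiftedSum_neg_inv s (ne_zero_of_im_pos hτ), shiftedSum_neg_inv s (ne_zero_of_im_pos hτ),
    mul_zero, mul_sub]

/-! ### Dependence on `τ` -/

lemma eventually_norm_kernel_zero_sub_le (A : ℝ) {B : ℝ} (hB : 0 < B) (a : ℂ) :
    ∃ C : ℝ, ∀ᶠ p in cofinite, ∀ τ : ℂ, |τ.re| ≤ A → B ≤ τ.im →
      ‖kernel 0 (point τ p + a) - kernel 0 (point τ p)‖ ≤ C * ‖p‖ ^ (-3 : ℝ) := by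
  obtain ⟨c, hc, h⟩ := exists_le_norm_point_of_strip A hB
  refine ⟨6 * ‖a‖ * c ^ (-3 : ℝ), ?_⟩
  filter_upwards [tendsto_norm_int_prod.eventually_gt_atTop 0,
    (tendsto_norm_int_prod.const_mul_atTop hc).eventually_ge_atTop (3 * ‖a‖)] with p hp0 hp τ h1 h2
  have hp' := h τ h1 h2 p
  have h0 : 0 < ‖point τ p‖ := lt_of_lt_of_le (by positivity) hp'
  have := norm_kernel_add_sub_le (z := point τ p) (a := a) (s := 0) (norm_pos_iff.mp h0)
    (by rw [norm_div, div_le_iff₀ h0]; linarith [norm_nonneg a])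
    (by rw [norm_div, norm_zero, ← mul_div_assoc, div_le_iff₀ h0]; linarith)
  refine this.trans ?_
  rw [norm_zero, zero_re, mul_assoc _ (c ^ (-3 : ℝ)), ← Real.mul_rpow hc.le hp0.le]
  have := Real.rpow_le_rpow_of_nonpos (by positivity) hp' (show (-3 : ℝ) ≤ 0 by norm_num)
  norm_num
  gcongr

lemma point_add_half_ne_zero {τ : ℂ} (hτ : 0 < τ.im) (p : ℤ × ℤ) : point τ p + 1 / 2 ≠ 0 := by
  intro h
  have h1 := congrArg im h
  have h2 := congrArg re h
  simp [point] at h1 h2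
  rcases h1 with h1 | h1
  · rw [h1] at h2
    have : ((2 * p.2 + 1 : ℤ) : ℝ) = 0 := by push_cast; linarith [h2]
    rw [Int.cast_eq_zero] at this
    omega
  · exact hτ.ne' h1

lemma point_ne_zero {τ : ℂ} (hτ : 0 < τ.im) {p : ℤ × ℤ} (hp : p ≠ 0) : point τ p ≠ 0 := by
  obtain ⟨c, hc, h⟩ := exists_le_norm_point hτ
  have : 0 < ‖p‖ := norm_pos_iff.mpr hp
  exact norm_pos_iff.mp (lt_of_lt_of_le (by positivity) (h p))

/-- The upper half-plane, as a set of complex numbers. -/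
abbrev upperSet : Set ℂ := {τ : ℂ | 0 < τ.im}

lemma isOpen_upperSet : IsOpen upperSet := isOpen_lt continuous_const continuous_im

lemma differentiableOn_regSum_zero_half :
    DifferentiableOn ℂ (fun τ => regSum 0 τ (1 / 2)) upperSet := by
  intro τ hτ
  have hτ' : 0 < τ.im := hτ
  obtain ⟨C, hC⟩ := eventually_norm_kernel_zero_sub_le (|τ.re| + 1)
    (half_pos hτ') (1 / 2)
  set U : Set ℂ := {w | |w.re| < |τ.re| + 1} ∩ {w | τ.im / 2 < w.im}
  have hU : IsOpen U :=
    (isOpen_lt (continuous_abs.comp continuous_re) continuous_const).inter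
      (isOpen_lt continuous_const continuous_im)
  have hT : TendstoUniformlyOn (fun (t : Finset (ℤ × ℤ)) w =>
      ∑ p ∈ t, (kernel 0 (point w p + 1 / 2) - kernel 0 (point w p)))
      (fun w => regSum 0 w (1 / 2)) atTop U := by
    refine tendstoUniformlyOn_tsum_of_cofinite_eventually
      ((summable_norm_int_prod (k := 3) (by norm_num)).mul_left C) ?_
    filter_upwards [hC] with p hp w hw
    exact hp w hw.1.le hw.2.le
  have hD : DifferentiableOn ℂ (fun w => regSum 0 w (1 / 2)) U := by
    refine hT.tendstoLocallyUniformlyOn.differentiableOn (Eventually.of_forall fun t => ?_) hU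
    refine DifferentiableOn.fun_sum fun p _ => ?_
    simp only [kernel_zero_left]
    have hd : Differentiable ℂ fun w => point w p := by unfold point; fun_prop
    have hpos (w : ℂ) (hw : w ∈ U) : 0 < w.im := (half_pos hτ').trans hw.2
    refine DifferentiableOn.sub ?_ ?_
    · exact ((hd.add_const _).pow 2).differentiableOn.inv fun w hw =>
        pow_ne_zero 2 (point_add_half_ne_zero (hpos w hw) p)
    · rcases eq_or_ne p 0 with rfl | hp
      · simp
      · exact (hd.pow 2).differentiableOn.inv fun w hw =>
          pow_ne_zero 2 (point_ne_zero (hpos w hw) hp)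
  refine (hD.differentiableAt (hU.mem_nhds ⟨?_, ?_⟩)).differentiableWithinAt
  · simp
  · simpa using hτ'

/-- Holomorphy in `τ` is proved directly only for the fixed argument `1/2`; inversion and
translation carry it to the two half-periods that move with `τ`. -/
lemma regSum_zero_half_period {τ : ℂ} (hτ : 0 < τ.im) :
    regSum 0 τ (τ / 2) = τ⁻¹ ^ 2 * regSum 0 (-1 / τ) (1 / 2) := by
  have h0 := ne_zero_of_im_pos hτ
  rw [regSum_zero_neg_inv hτ, mul_one_div]
  field_simp

lemma differentiableOn_regSum_zero_half_period :
    DifferentiableOn ℂ (fun τ => regSum 0 τ (τ / 2)) upperSet := by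
  have h : DifferentiableOn ℂ (fun τ => τ⁻¹ ^ 2 * regSum 0 (-1 / τ) (1 / 2)) upperSet := by
    refine DifferentiableOn.mul ?_ ?_
    · exact (differentiableOn_inv.mono fun τ hτ => ne_zero_of_im_pos hτ).pow 2
    · refine differentiableOn_regSum_zero_half.comp (t := upperSet) ?_ fun τ hτ =>
        im_neg_one_div_pos hτ
      exact (differentiableOn_const _).div differentiableOn_id fun τ hτ => ne_zero_of_im_pos hτ
  exact h.congr fun τ hτ => regSum_zero_half_period hτ

lemma regSum_zero_half_sum {τ : ℂ} (hτ : 0 < τ.im) :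
    regSum 0 τ ((1 + τ) / 2) = regSum 0 (τ + 1) ((τ + 1) / 2) := by
  have := regSum_zero_add_int hτ ((τ + 1) / 2) 1
  rw [Int.cast_one] at this
  rw [this, add_comm]

lemma differentiableOn_regSum_zero_half_sum :
    DifferentiableOn ℂ (fun τ => regSum 0 τ ((1 + τ) / 2)) upperSet := by
  have h : DifferentiableOn ℂ (fun τ => regSum 0 (τ + 1) ((τ + 1) / 2)) upperSet :=
    differentiableOn_regSum_zero_half_period.comp (t := upperSet) (by fun_prop) fun τ hτ => by
      simpa using hτ
  exact h.congr fun τ hτ => regSum_zero_half_sum hτ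

/-- The sum of the values of `℘` at the three half-periods. -/
def halfPeriodSum (τ : ℂ) : ℂ :=
  regSum 0 τ (1 / 2) + regSum 0 τ (τ / 2) + regSum 0 τ ((1 + τ) / 2)

lemma tendsto_mul_shiftedSum_zero {τ : ℂ} (hτ : 0 < τ.im) :
    Tendsto (fun s => (1 - 4 * kernel s 2) * shiftedSum s τ 0) rightOfZero
      (𝓝 (1 / 4 * halfPeriodSum τ)) := by
  have h := (tendsto_kernel 2).mul (((tendsto_regSum hτ (1 / 2)).add
    (tendsto_regSum hτ (τ / 2))).add (tendsto_regSum hτ ((1 + τ) / 2)))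
  norm_num at h
  refine (h.congr' ?_).trans_eq ?_
  · exact eventually_rightOfZero.mono fun s hs => by
      have := shiftedSum_zero_mul hτ hs
      norm_num at this
      exact this.symm
  · norm_num [halfPeriodSum]

/-- For `Re s > 0` the series at `2τ` is `kernel s 2` times twice the series at `τ` plus `regSum s τ
(1/2)`. Multiplied by `1 - 4 * kernel s 2`, which tends to `0`, the `regSum` term drops out. -/
lemma halfPeriodSum_two_mul {τ : ℂ} (hτ : 0 < τ.im) :
    halfPeriodSum (2 * τ) = 1 / 2 * halfPeriodSum τ := by
  have hτ2 : 0 < (2 * τ).im := by simpa using hτ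
  have h1 := tendsto_mul_shiftedSum_zero hτ2
  have h2 : Tendsto (fun s => kernel s 2 * (2 * ((1 - 4 * kernel s 2) * shiftedSum s τ 0) +
      (1 - 4 * kernel s 2) * regSum s τ (1 / 2))) rightOfZero
      (𝓝 ((2 ^ 2 : ℂ)⁻¹ * (2 * (1 / 4 * halfPeriodSum τ) +
        (1 - 4 * (2 ^ 2 : ℂ)⁻¹) * regSum 0 τ (1 / 2)))) :=
    (tendsto_kernel 2).mul (((tendsto_mul_shiftedSum_zero hτ).const_mul 2).add
      (((tendsto_const_nhds).sub ((tendsto_kernel 2).const_mul 4)).mul (tendsto_regSum hτ _)))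
  have h3 := tendsto_nhds_unique h1 (h2.congr' ?_)
  · norm_num at h3
    linear_combination h3
  · refine eventually_rightOfZero.mono fun s hs => ?_
    have e := shiftedSum_nat_mul 2 hτ 0 hs
    simp only [Fin.sum_univ_two, Nat.cast_ofNat, Fin.val_zero, Fin.val_one, Nat.cast_zero,
      Nat.cast_one, add_zero, zero_div] at e
    simp only [e, regSum_eq hτ _ hs]
    ring

lemma halfPeriodSum_add_one {τ : ℂ} (hτ : 0 < τ.im) :
    halfPeriodSum (τ + 1) = halfPeriodSum τ := by
  have h (a : ℂ) := regSum_zero_add_int hτ a 1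
  simp only [Int.cast_one] at h
  simp only [halfPeriodSum, h]
  rw [regSum_zero_shift hτ 0 1 (show (1 + (τ + 1)) / 2 = τ / 2 + ((0 : ℤ) * τ + (1 : ℤ)) by
    push_cast; ring), add_comm τ 1]
  ring

/-- By the doubling relation, a period of the function at `2τ` is twice a period at `τ`. -/
lemma halfPeriodSum_add_pow {τ : ℂ} (hτ : 0 < τ.im) (k : ℕ) :
    halfPeriodSum (τ + 1 / 2 ^ k) = halfPeriodSum τ := by
  induction k generalizing τ with
  | zero => simpa using halfPeriodSum_add_one hτ
  | succ k ih =>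
    have him : ((1 : ℂ) / 2 ^ (k + 1)).im = 0 := by
      have : (1 : ℂ) / 2 ^ (k + 1) = ((1 / 2 ^ (k + 1) : ℝ) : ℂ) := by push_cast; rfl
      rw [this, ofReal_im]
    have h1 := halfPeriodSum_two_mul (τ := τ + 1 / 2 ^ (k + 1)) (by rw [add_im, him]; simpa)
    have h2 := ih (τ := 2 * τ) (by simpa using hτ)
    rw [show 2 * (τ + 1 / 2 ^ (k + 1)) = 2 * τ + 1 / 2 ^ k by field_simp; ring, h2,
      halfPeriodSum_two_mul hτ] at h1
    linear_combination -2 * h1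

lemma differentiableOn_halfPeriodSum : DifferentiableOn ℂ halfPeriodSum upperSet :=
  (differentiableOn_regSum_zero_half.add differentiableOn_regSum_zero_half_period).add
    differentiableOn_regSum_zero_half_sum

/-- The periods `2^{-k}` tend to `0`, so the derivative vanishes and the function is constant;
doubling halves this constant, which is therefore `0`. -/
lemma halfPeriodSum_eq_zero {τ : ℂ} (hτ : 0 < τ.im) : halfPeriodSum τ = 0 := by
  have hderiv : Set.EqOn (deriv halfPeriodSum) 0 upperSet := by
    intro τ hτ
    have hd := (differentiableOn_halfPeriodSum.differentiableAt
      (isOpen_upperSet.mem_nhds hτ)).hasDerivAt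
    rw [hasDerivAt_iff_tendsto_slope_zero] at hd
    have hseq : Tendsto (fun k : ℕ => (1 : ℂ) / 2 ^ k) atTop (𝓝[≠] 0) := by
      refine tendsto_nhdsWithin_iff.mpr ⟨?_, Eventually.of_forall fun k => by simp⟩
      have := tendsto_pow_atTop_nhds_zero_of_norm_lt_one (x := (1 / 2 : ℂ)) (by norm_num)
      simpa using this
    refine tendsto_nhds_unique (hd.comp hseq) (tendsto_const_nhds.congr fun k => ?_)
    simp only [Function.comp_apply, halfPeriodSum_add_pow hτ, sub_self, smul_zero, Pi.zero_apply]
  have hconv : IsPreconnected upperSet := (convex_halfSpace_im_gt 0).isPreconnected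
  have h := isOpen_upperSet.is_const_of_deriv_eq_zero hconv differentiableOn_halfPeriodSum hderiv
    (show (2 * τ) ∈ upperSet by simpa using hτ) (show τ ∈ upperSet from hτ)
  rw [halfPeriodSum_two_mul hτ] at h
  linear_combination -2 * h

/-! ### Existence of the limit defining `G_2^*` -/

/-- Both sides of `shiftedSum_zero_mul` vanish to first order at `0`; after division by `s` the
factor on the left tends to `log 4 ≠ 0`. -/
lemma exists_tendsto_shiftedSum_zero {τ : ℂ} (hτ : 0 < τ.im) :
    ∃ l, Tendsto (fun s => shiftedSum s τ 0) rightOfZero (𝓝 l) := by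
  set A : ℂ → ℂ := fun s => regSum s τ (1 / 2) + regSum s τ (τ / 2) + regSum s τ ((1 + τ) / 2)
  have hA0 : A 0 = 0 := halfPeriodSum_eq_zero hτ
  have hmem : {s : ℂ | -(1 / 2) < s.re} ∈ 𝓝 0 :=
    (isOpen_lt continuous_const continuous_re).mem_nhds (by norm_num)
  have hA : HasDerivAt A (deriv A 0) 0 :=
    ((((differentiableOn_regSum hτ _).add (differentiableOn_regSum hτ _)).add
      (differentiableOn_regSum hτ _)).differentiableAt hmem).hasDerivAt
  have hle : rightOfZero ≤ 𝓝[≠] 0 := nhdsWithin_mono _ fun s hs h => by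
    rw [Set.mem_singleton_iff.mp h] at hs
    simp at hs
  have h1 := hA.tendsto_slope_zero.mono_left hle
  have hB : HasDerivAt (fun s => 1 - 4 * kernel s 2) (Real.log 4 : ℝ) 0 := by
    have e : (fun s => 1 - 4 * kernel s 2) = fun s => 1 - cexp (-s * (Real.log 4 : ℝ)) := by
      funext s
      simp only [kernel, normSq_ofNat]
      norm_num
      ring
    rw [e]
    convert! (((hasDerivAt_id (0 : ℂ)).neg.mul_const ((Real.log 4 : ℝ) : ℂ)).cexp.const_sub 1)
      using 1
    simp
  have h2 := hB.tendsto_slope_zero.mono_left hle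
  have hne : ((Real.log 4 : ℝ) : ℂ) ≠ 0 := by
    exact_mod_cast (Real.log_pos (by norm_num)).ne'
  refine ⟨_, (((tendsto_kernel 2).mul h1).div h2 hne).congr' ?_⟩
  have h3 : ∀ᶠ s in rightOfZero, s⁻¹ • (1 - 4 * kernel s 2) ≠ 0 := by
    filter_upwards [h2.eventually_ne hne] with s hs
    rw [zero_add, show 1 - 4 * kernel 0 2 = 0 by rw [kernel_zero_left]; norm_num, sub_zero] at hs
    exact hs
  filter_upwards [h3, eventually_rightOfZero] with s hs hs0
  simp only [smul_eq_mul, ne_eq, mul_eq_zero, not_or] at hs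
  obtain ⟨hs1, hs2⟩ := hs
  have e := shiftedSum_zero_mul hτ hs0
  simp only [zero_add, hA0, sub_zero, smul_eq_mul, Pi.div_apply,
    show 1 - 4 * kernel 0 2 = 0 by rw [kernel_zero_left]; norm_num]
  rw [div_eq_iff (mul_ne_zero hs1 hs2)]
  linear_combination -(s⁻¹) * e

lemma eisensteinG_two {τ : ℂ} (hτ : 0 < τ.im) (s : ℂ) :
    eisensteinG 2 s τ = ((τ.im : ℝ) : ℂ) ^ s * (1 / 2 * shiftedSum s τ 0) := by
  have h1 : shiftedSum s τ 0 = ∑' p : {p : ℤ × ℤ // p ≠ (0, 0)}, kernel s (point τ p) := by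
    rw [shiftedSum]
    simp only [add_zero]
    exact (tsum_subtype_eq_of_support_subset (s := {p : ℤ × ℤ | p ≠ (0, 0)}) fun p hp h => by
      rw [h] at hp
      exact hp (by simp [point])).symm
  rw [eisensteinG, h1, mul_left_comm]
  refine congrArg ((1 / 2 : ℂ) * ·) ?_
  rw [← tsum_mul_left]
  refine tsum_congr fun p => ?_
  have hz : point τ p ≠ 0 := point_ne_zero hτ p.2
  have hz' : ((‖point τ p‖ : ℝ) : ℂ) ≠ 0 := by simpa using hz
  rw [kernel, normSq_eq_norm_sq, Real.log_pow, ← point, div_eq_mul_inv _ (_ ^ (2 * s)),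
    Complex.cpow_def_of_ne_zero hz', ← Complex.exp_neg, ← Complex.ofReal_log (norm_nonneg _)]
  push_cast
  rw [one_div, mul_left_comm]
  ring_nf

lemma tendsto_cpow_rightOfZero {y : ℝ} (hy : 0 < y) :
    Tendsto (fun s : ℂ => (y : ℂ) ^ s) rightOfZero (𝓝 1) := by
  have hy' : (y : ℂ) ≠ 0 := by exact_mod_cast hy.ne'
  have h : Continuous fun s : ℂ => (y : ℂ) ^ s := by
    exact Continuous.const_cpow continuous_id (Or.inl hy')
  have := h.tendsto 0
  rw [cpow_zero] at this
  exact this.mono_left nhdsWithin_le_nhds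

theorem tendsto_eisensteinG {τ : ℂ} (hτ : 0 < τ.im) :
    Tendsto (fun s => eisensteinG 2 s τ) rightOfZero (𝓝 (G2star τ)) := by
  obtain ⟨l, hl⟩ := exists_tendsto_shiftedSum_zero hτ
  refine tendsto_nhds_limUnder ⟨1 * (1 / 2 * l), ?_⟩
  simp only [eisensteinG_two hτ]
  exact (tendsto_cpow_rightOfZero hτ).mul (hl.const_mul _)

lemma tendsto_shiftedSum_zero {τ : ℂ} (hτ : 0 < τ.im) :
    Tendsto (fun s => shiftedSum s τ 0) rightOfZero (𝓝 (2 * G2star τ)) := by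
  obtain ⟨l, hl⟩ := exists_tendsto_shiftedSum_zero hτ
  have h := tendsto_eisensteinG hτ
  simp only [eisensteinG_two hτ] at h
  have := tendsto_nhds_unique h ((tendsto_cpow_rightOfZero hτ).mul (hl.const_mul _))
  rw [this]
  convert hl using 2
  ring

/-! ### A vanishing criterion for the theta group -/

/-- The filter of neighbourhoods of `i∞`. -/
abbrev imInfty : Filter ℂ := comap im atTop

lemma eventually_imInfty (B : ℝ) : ∀ᶠ τ : ℂ in imInfty, B < τ.im :=
  tendsto_comap.eventually_gt_atTop B

lemma tendsto_add_real_imInfty (x : ℝ) : Tendsto (fun τ : ℂ => τ + x) imInfty imInfty := by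
  refine tendsto_comap_iff.mpr ?_
  simpa [Function.comp_def] using (tendsto_comap : Tendsto im imInfty atTop)

lemma isBigO_exp_of_tendsto_zero {f : ℂ → ℂ} (hd : DifferentiableOn ℂ f upperSet)
    (hT : ∀ τ : ℂ, 0 < τ.im → f (τ + 2) = f τ) (h0 : Tendsto f imInfty (𝓝 0)) :
    f =O[imInfty] fun τ => Real.exp (-Real.pi * τ.im) := by
  classical
  -- Extension by `0` makes the period `2` hold on all of `ℂ`.
  set g : ℂ → ℂ := fun τ => if 0 < τ.im then f τ else 0
  have hfg : g =ᶠ[imInfty] f := by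
    filter_upwards [eventually_imInfty 0] with τ hτ
    simp [g, hτ]
  have hper : Function.Periodic g ((2 : ℝ) : ℂ) := by
    intro τ
    by_cases hτ : 0 < τ.im
    · simp [g, hτ, hT τ hτ]
    · simp [g, hτ]
  have hdiff : ∀ᶠ τ in imInfty, DifferentiableAt ℂ g τ := by
    filter_upwards [eventually_imInfty 0] with τ hτ
    have hmem := isOpen_upperSet.mem_nhds (show τ ∈ upperSet from hτ)
    refine (hd.differentiableAt hmem).congr_of_eventuallyEq ?_
    filter_upwards [hmem] with w hw
    exact if_pos hw
  have h := Function.Periodic.exp_decay_of_zero_at_inf two_pos hper hdiff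
    (h0.congr' hfg.symm)
  refine (h.congr' hfg (Eventually.of_forall fun τ => ?_))
  simp only
  congr 1
  ring

-- Such a `Q` is a multiple of the discriminant, whose decay is no faster than `exp(-2π Im τ)`, so
-- the bound `exp(-6π Im τ)` forces the multiple to be `0`.
open UpperHalfPlane ModularForm MatrixGroups in
lemma eq_zero_of_weight_twelve {Q : ℂ → ℂ} (hd : DifferentiableOn ℂ Q upperSet)
    (hT : ∀ τ : ℂ, 0 < τ.im → Q (τ + 1) = Q τ)
    (hS : ∀ τ : ℂ, 0 < τ.im → Q (-1 / τ) = τ ^ 12 * Q τ)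
    (hO : Q =O[imInfty] fun τ => Real.exp (-6 * Real.pi * τ.im)) {τ : ℂ} (hτ : 0 < τ.im) :
    Q τ = 0 := by
  have hcoe : Tendsto (fun z : ℍ => (z : ℂ)) atImInfty imInfty :=
    tendsto_comap_iff.mpr tendsto_comap
  have hO' : (fun z : ℍ => Q z) =O[atImInfty] fun z => Real.exp (-6 * Real.pi * z.im) :=
    hO.comp_tendsto hcoe
  have hexp (a : ℝ) (ha : a < 0) :
      Tendsto (fun z : ℍ => Real.exp (a * z.im)) atImInfty (𝓝 0) :=
    Real.tendsto_exp_atBot.comp (tendsto_comap.const_mul_atTop_of_neg ha)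
  have hSf : (fun z : ℍ => Q z) ∣[(12 : ℤ)] ModularGroup.S = fun z : ℍ => Q z := by
    funext z
    rw [SlashInvariantForm.slash_S_apply]
    have h := hS z z.im_pos
    have hz : (z : ℂ) ≠ 0 := z.ne_zero
    simp only
    rw [show (-(z : ℂ))⁻¹ = -1 / z by field_simp, h, zpow_neg]
    norm_cast
    field_simp
  have hTf : (fun z : ℍ => Q z) ∣[(12 : ℤ)] ModularGroup.T = fun z : ℍ => Q z := by
    funext z
    rw [ModularForm.SL_slash_apply, UpperHalfPlane.modular_T_smul]
    have hden : denom ((ModularGroup.T : SL(2, ℤ)) : GL (Fin 2) ℝ) z = 1 := by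
      change (((0 : ℤ) : ℝ) : ℂ) * z + (((1 : ℤ) : ℝ) : ℂ) = 1
      simp
    rw [hden]
    simp only [coe_vadd, ofReal_one]
    rw [add_comm, hT z z.im_pos]
    simp
  have hinv := SlashInvariantForm.slash_action_generators_SL2Z hSf hTf
  let F : CuspForm 𝒮ℒ 12 :=
    { toFun := fun z => Q z
      slash_action_eq' := by
        rintro A ⟨A, rfl⟩
        exact hinv A
      holo' := by
        rw [UpperHalfPlane.mdifferentiable_iff]
        refine hd.congr fun w hw => ?_
        simp [ofComplex_apply_of_im_pos (show 0 < w.im from hw)]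
      zero_at_cusps' := fun hc => by
        rw [Subgroup.IsArithmetic.isCusp_iff_isCusp_SL2Z] at hc
        rw [OnePoint.isZeroAt_iff_forall_SL2Z hc]
        intro γ _
        change IsZeroAtImInfty ((fun z : ℍ => Q z) ∣[(12 : ℤ)] γ)
        rw [hinv]
        exact hO'.trans_tendsto (hexp _ (by linarith [Real.pi_pos])) }
  obtain ⟨c, hc⟩ := F.exists_smul_discriminant_of_weight_eq_twelve
  have hQ (z : ℍ) : Q z = c * ModularForm.discriminant z := (DFunLike.congr_fun hc z).symm
  suffices c = 0 by
    rw [show Q τ = _ from hQ ⟨τ, hτ⟩, this, zero_mul]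
  have h1 : (fun z : ℍ => ‖c‖ * Real.exp (-2 * Real.pi * z.im)) =O[atImInfty]
      fun z => Real.exp (-6 * Real.pi * z.im) := by
    refine Asymptotics.IsBigO.trans ?_ hO'
    have := ((Asymptotics.isBigO_refl (fun _ : ℍ => c) atImInfty).norm_left).mul
      exp_isBigO_discriminant
    exact this.congr_right fun z => (hQ z).symm
  have h2 : (fun _ : ℍ => ‖c‖) =O[atImInfty] fun z => Real.exp (-4 * Real.pi * z.im) := by
    have := h1.mul (Asymptotics.isBigO_refl (fun z : ℍ => Real.exp (2 * Real.pi * z.im)) atImInfty)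
    refine (this.congr_left fun z => ?_).congr_right fun z => ?_
    · rw [mul_assoc, ← Real.exp_add]
      ring_nf
      simp
    · rw [← Real.exp_add]
      ring_nf
  rw [← norm_eq_zero]
  exact tendsto_nhds_unique tendsto_const_nhds
    (h2.trans_tendsto (hexp (-4 * Real.pi) (by linarith [Real.pi_pos])))

/-- The functions `f`, `f(τ + 1)`, `τ⁻² f(-1/τ)` are permuted, up to signs and factors of weight 2,
by the generators of the modular group. Each has period `2` and tends to `0`, hence is `O(exp(-π Im
τ))`; the square of their product has weight 12, level one and decay `exp(-6π Im τ)`, so it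
vanishes, and one of the factors is identically `0`. -/
lemma eq_zero_of_thetaGroup {f : ℂ → ℂ} (hd : DifferentiableOn ℂ f upperSet)
    (hT : ∀ τ : ℂ, 0 < τ.im → f (τ + 2) = f τ)
    (hS : ∀ τ : ℂ, 0 < τ.im → f (-1 / τ + 1) = -τ ^ 2 * f (τ + 1))
    (h0 : Tendsto f imInfty (𝓝 0))
    (h0' : Tendsto (fun τ => τ⁻¹ ^ 2 * f (-1 / τ)) imInfty (𝓝 0)) {τ : ℂ} (hτ : 0 < τ.im) :
    f τ = 0 := by
  set f₁ : ℂ → ℂ := fun τ => f (τ + 1)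
  set f₂ : ℂ → ℂ := fun τ => τ⁻¹ ^ 2 * f (-1 / τ)
  have hd₁ : DifferentiableOn ℂ f₁ upperSet :=
    hd.comp (t := upperSet) (by fun_prop) fun τ hτ => by simpa using hτ
  have hdS : DifferentiableOn ℂ (fun τ => f (-1 / τ)) upperSet := by
    refine hd.comp (t := upperSet) ?_ fun τ hτ => im_neg_one_div_pos hτ
    exact (differentiableOn_const _).div differentiableOn_id fun τ hτ => ne_zero_of_im_pos hτ
  have hd₂ : DifferentiableOn ℂ f₂ upperSet :=
    ((differentiableOn_inv.mono fun τ hτ => ne_zero_of_im_pos hτ).pow 2).mul hdS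
  have h1 (τ : ℂ) (hτ : 0 < τ.im) : 0 < (τ + 1).im := by simpa using hτ
  have hf₁ (τ : ℂ) (hτ : 0 < τ.im) : f₁ (τ + 1) = f τ := by
    simp only [f₁]
    rw [add_assoc, one_add_one_eq_two, hT τ hτ]
  have hf₂ (τ : ℂ) (hτ : 0 < τ.im) : f₂ (τ + 1) = -f₂ τ := by
    have hn := ne_zero_of_im_pos hτ
    have hn1 := ne_zero_of_im_pos (h1 τ hτ)
    have hσ := im_neg_one_div_pos (h1 τ hτ)
    have hσ' := h1 _ hσ
    have hn2 := ne_zero_of_im_pos hσ'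
    -- Used at `z = τ/(τ + 1)`, where `-1/z + 1 = -1/τ` and `z + 1` is `-1/(τ + 1)` up to the period
    -- `2`.
    have e := hS _ hσ'
    rw [show -1 / (-1 / (τ + 1) + 1) + 1 = -1 / τ by
      rw [show -1 / (τ + 1) + 1 = τ / (τ + 1) by field_simp; ring]
      field_simp
      ring, add_assoc, one_add_one_eq_two, hT _ hσ,
      show -1 / (τ + 1) + 1 = τ / (τ + 1) by field_simp; ring] at e
    simp only [f₂]
    rw [e]
    field_simp
  have hO := isBigO_exp_of_tendsto_zero hd hT h0
  have hO₁ := isBigO_exp_of_tendsto_zero hd₁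
    (fun τ hτ => by
      simp only [f₁]
      rw [add_right_comm, hT _ (h1 τ hτ)])
    (by
      have := tendsto_add_real_imInfty 1
      rw [ofReal_one] at this
      exact h0.comp this)
  have hO₂ := isBigO_exp_of_tendsto_zero hd₂
    (fun τ hτ => by
      rw [← one_add_one_eq_two, ← add_assoc, hf₂ _ (h1 τ hτ), hf₂ _ hτ, neg_neg]) h0'
  set P : ℂ → ℂ := fun τ => f τ * f₁ τ * f₂ τ
  have hPd : DifferentiableOn ℂ P upperSet := (hd.mul hd₁).mul hd₂
  have hPT (τ : ℂ) (hτ : 0 < τ.im) : P (τ + 1) = -P τ := by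
    simp only [P]
    rw [hf₁ τ hτ, hf₂ τ hτ]
    simp only [f₁]
    ring
  have hPS (τ : ℂ) (hτ : 0 < τ.im) : P (-1 / τ) = -τ ^ 6 * P τ := by
    have hn := ne_zero_of_im_pos hτ
    simp only [P, f₁, f₂]
    rw [hS τ hτ, show -1 / (-1 / τ) = τ by field_simp]
    field_simp
  have hP : Set.EqOn P 0 upperSet := fun τ hτ => by
    have := eq_zero_of_weight_twelve (Q := fun τ => P τ ^ 2) (hPd.pow 2)
      (fun τ hτ => by simp only [hPT τ hτ, neg_sq])
      (fun τ hτ => by simp only [hPS τ hτ]; ring)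
      (by
        refine (((hO.mul hO₁).mul hO₂).pow 2).congr_right fun τ => ?_
        rw [← Real.exp_add, ← Real.exp_add, ← Real.exp_nat_mul]
        congr 1
        push_cast
        ring) hτ
    simpa using this
  have hconv : IsPreconnected upperSet := (convex_halfSpace_im_gt 0).isPreconnected
  have hf : Set.EqOn f 0 upperSet ∨ Set.EqOn f₁ 0 upperSet ∨ Set.EqOn f₂ 0 upperSet := by
    rcases AnalyticOnNhd.eq_zero_or_eq_zero_of_mul_eq_zero
      ((hd.mul hd₁).analyticOnNhd isOpen_upperSet) (hd₂.analyticOnNhd isOpen_upperSet)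
      (fun τ hτ => hP hτ) hconv with h | h
    · rcases AnalyticOnNhd.eq_zero_or_eq_zero_of_mul_eq_zero
        (hd.analyticOnNhd isOpen_upperSet) (hd₁.analyticOnNhd isOpen_upperSet)
        (fun τ hτ => h τ hτ) hconv with h | h
      · exact Or.inl fun τ hτ => h τ hτ
      · exact Or.inr (Or.inl fun τ hτ => h τ hτ)
    · exact Or.inr (Or.inr fun τ hτ => h τ hτ)
  rcases hf with h | h | h
  · exact h hτ
  · rw [← hf₁ τ hτ]
    exact h (h1 τ hτ)
  · have := h (im_neg_one_div_pos hτ)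
    simp only [f₂, Pi.zero_apply] at this
    have hn := ne_zero_of_im_pos hτ
    rw [show -1 / (-1 / τ) = τ by field_simp] at this
    simpa [hn] using this

/-! ### Behaviour at `i∞` -/

/-- On the finitely many exceptional indices, `‖g k‖ + 1` eventually serves as a bound. -/
lemma tendsto_tsum_of_cofinite_bound {α β : Type*} {l : Filter α} {f : α → β → ℂ} {g : β → ℂ}
    {bound : β → ℝ} {S : Set α} (hS : S ∈ l) (hsum : Summable bound)
    (hlim : ∀ k, Tendsto (f · k) l (𝓝 (g k)))
    (hb : ∀ᶠ k in cofinite, ∀ n ∈ S, ‖f n k‖ ≤ bound k) :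
    Tendsto (fun n => ∑' k, f n k) l (𝓝 (∑' k, g k)) := by
  classical
  rw [eventually_cofinite] at hb
  set T : Set β := {k | ¬ ∀ n ∈ S, ‖f n k‖ ≤ bound k}
  refine tendsto_tsum_of_dominated_convergence
    (bound := fun k => if k ∈ T then ‖g k‖ + 1 else bound k) ?_ hlim ?_
  · refine hsum.congr_cofinite ?_
    filter_upwards [hb.compl_mem_cofinite] with k hk
    exact (if_neg hk).symm
  · have h1 : ∀ᶠ n in l, ∀ k ∈ T, ‖f n k‖ ≤ ‖g k‖ + 1 := by
      rw [eventually_all_finite hb]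
      intro k _
      exact (hlim k).norm.eventually_le_const (lt_add_one _)
    filter_upwards [h1, hS] with n hn hnS k
    by_cases hk : k ∈ T
    · simpa [hk] using hn k hk
    · simp only [hk, if_false]
      exact (not_not.mp hk) n hnS

/-- `i∞` within a vertical strip of width `2`. -/
def stripInfty : Filter ℂ := imInfty ⊓ 𝓟 {τ | |τ.re| ≤ 1}

lemma mem_stripInfty : {τ : ℂ | |τ.re| ≤ 1 ∧ 1 ≤ τ.im} ∈ stripInfty := by
  refine mem_inf_of_inter ((eventually_imInfty 1)) (mem_principal_self _) ?_
  rintro τ ⟨h1, h2⟩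
  exact ⟨h2, (show 1 < τ.im from h1).le⟩

/-- The lattice bounds are uniform only in strips; period `2` moves every `τ` into `|Re τ| ≤ 1`. -/
lemma tendsto_imInfty_of_stripInfty {f : ℂ → ℂ} {c : ℂ}
    (hf : ∀ τ : ℂ, 0 < τ.im → ∀ k : ℤ, f (τ + ((2 * k : ℤ) : ℂ)) = f τ)
    (h : Tendsto f stripInfty (𝓝 c)) : Tendsto f imInfty (𝓝 c) := by
  have hρ : Tendsto (fun τ : ℂ => τ + ((2 * -round (τ.re / 2) : ℤ) : ℂ)) imInfty stripInfty := by
    refine tendsto_inf.mpr ⟨tendsto_comap_iff.mpr ?_, tendsto_principal.mpr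
      (Eventually.of_forall fun τ => ?_)⟩
    · simpa [Function.comp_def] using (tendsto_comap : Tendsto im imInfty atTop)
    · have := abs_sub_round (τ.re / 2)
      rw [abs_le] at this
      simp only [Set.mem_ofPred_eq, add_re, intCast_re]
      push_cast
      rw [abs_le]
      constructor <;> linarith [this.1, this.2]
  refine (h.comp hρ).congr' ?_
  filter_upwards [eventually_imInfty 0] with τ hτ
  exact hf τ hτ _

lemma tendsto_kernel_zero_stripInfty {c : ℝ} (hc : c ≠ 0) (d : ℂ) :
    Tendsto (fun τ : ℂ => kernel 0 (c * τ + d)) stripInfty (𝓝 0) := by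
  have h1 : Tendsto (fun τ : ℂ => (c * τ + d)) imInfty (Bornology.cobounded ℂ) := by
    rw [← tendsto_norm_atTop_iff_cobounded]
    have h2 : Tendsto (fun τ : ℂ => |c| * τ.im - |d.im|) imInfty atTop :=
      tendsto_atTop_add_const_right _ _ (tendsto_comap.const_mul_atTop (abs_pos.mpr hc))
    refine tendsto_atTop_mono' _ ?_ h2
    filter_upwards [eventually_imInfty 0] with τ hτ
    refine le_trans ?_ (abs_im_le_norm _)
    rw [add_im, im_ofReal_mul]
    have := abs_sub_abs_le_abs_sub (c * τ.im) (-d.im)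
    rw [abs_neg, sub_neg_eq_add, abs_mul, abs_of_pos hτ] at this
    exact this
  have h3 := (tendsto_inv₀_cobounded.comp h1).pow 2
  simp only [kernel_zero_left, ← inv_pow]
  rw [zero_pow two_ne_zero] at h3
  exact h3.mono_left inf_le_left

lemma tsum_inv_sq_int : ∑' n : ℤ, kernel 0 (n : ℂ) = Real.pi ^ 2 / 3 := by
  have h := two_mul_riemannZeta_eq_tsum_int_inv_pow_of_even (k := 2) (by norm_num) (by norm_num)
  simp only [kernel_zero_left]
  rw [Nat.cast_ofNat] at h
  rw [← h, riemannZeta_two]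
  ring

lemma summable_kernel_zero_int (a : ℂ) : Summable fun n : ℤ => kernel 0 ((n : ℂ) + a) := by
  have := EisensteinSeries.linear_right_summable a 1 (k := 2) le_rfl
  simp only [kernel_zero_left]
  refine this.congr fun n => ?_
  rw [Int.cast_one, one_mul, add_comm]
  norm_cast

/-- Separating even and odd `n` in `∑ 1/n² = π²/3` gives `∑ 1/(n + 1/2)² = 3 · π²/3`. -/
lemma tsum_inv_sq_int_add_half :
    ∑' n : ℤ, (kernel 0 ((n : ℂ) + 1 / 2) - kernel 0 (n : ℂ)) = 2 * Real.pi ^ 2 / 3 := by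
  have hs0 : Summable fun n : ℤ => kernel 0 (n : ℂ) := by
    simpa using summable_kernel_zero_int 0
  have h1 := tsum_inv_sq_int
  have h2 : ∑' n : ℤ, kernel 0 (n : ℂ) =
      4⁻¹ * (∑' n : ℤ, kernel 0 (n : ℂ)) + 4⁻¹ * ∑' n : ℤ, kernel 0 ((n : ℂ) + 1 / 2) := by
    let e := (Equiv.prodComm (Fin 2) ℤ).trans (Int.divModEquiv 2).symm
    have hs := e.summable_iff.mpr hs0
    conv_lhs => rw [← e.tsum_eq]
    refine (hs.tsum_prod.trans (tsum_fintype _)).trans ?_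
    rw [Fin.sum_univ_two, ← tsum_mul_left, ← tsum_mul_left]
    have hk : kernel 0 2 = 4⁻¹ := by rw [kernel_zero_left]; norm_num
    congr 1 <;>
    · refine tsum_congr fun n => ?_
      rw [← hk, ← kernel_mul]
      simp [e]
      ring_nf
  rw [(summable_kernel_zero_int _).tsum_sub hs0]
  linear_combination 2 * h1 - 4 * h2

/-- Only the row `m = 0` survives at `i∞`. -/
lemma tendsto_regSum_zero_half :
    Tendsto (fun τ => regSum 0 τ (1 / 2)) imInfty (𝓝 (2 * Real.pi ^ 2 / 3)) := by
  refine tendsto_imInfty_of_stripInfty (fun τ hτ k => regSum_zero_add_int hτ _ _) ?_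
  obtain ⟨C, hC⟩ := eventually_norm_kernel_zero_sub_le 1 one_pos (1 / 2)
  have h := tendsto_tsum_of_cofinite_bound
    (f := fun τ p => kernel 0 (point τ p + 1 / 2) - kernel 0 (point τ p))
    (g := fun p : ℤ × ℤ =>
      if p.1 = 0 then kernel 0 ((p.2 : ℂ) + 1 / 2) - kernel 0 (p.2 : ℂ) else 0)
    mem_stripInfty ((summable_norm_int_prod (k := 3) (by norm_num)).mul_left C) (fun p => ?_)
    (hC.mono fun p hp τ hτ => hp τ hτ.1 hτ.2)
  · refine h.trans_eq ?_
    rw [← tsum_inv_sq_int_add_half]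
    congr 1
    have hi : Function.Injective fun n : ℤ => ((0 : ℤ), n) := fun a b hab => by simpa using hab
    rw [← hi.tsum_eq]
    · simp
    · intro p hp
      have : p.1 = 0 := by
        by_contra h
        simp [h] at hp
      exact ⟨p.2, Prod.ext this.symm rfl⟩
  · by_cases hp : p.1 = 0
    · simp only [hp, if_true, point, Int.cast_zero, zero_mul, zero_add]
      exact tendsto_const_nhds
    · have hp' : (p.1 : ℝ) ≠ 0 := by exact_mod_cast hp
      have h1 := tendsto_kernel_zero_stripInfty hp' ((p.2 : ℂ) + 1 / 2)
      have h2 := tendsto_kernel_zero_stripInfty hp' (p.2 : ℂ)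
      simpa [hp, point, add_assoc] using h1.sub h2

lemma tendsto_regSum_zero_half_period_sub :
    Tendsto (fun τ => regSum 0 τ (τ / 2) - regSum 0 τ ((1 + τ) / 2)) imInfty (𝓝 0) := by
  refine tendsto_imInfty_of_stripInfty (fun τ hτ k => ?_) ?_
  · rw [regSum_zero_add_int hτ, regSum_zero_add_int hτ,
      regSum_zero_shift hτ 0 k (show (τ + ((2 * k : ℤ) : ℂ)) / 2 = τ / 2 + ((0 : ℤ) * τ + k) by
        push_cast; ring),
      regSum_zero_shift hτ 0 k (show (1 + (τ + ((2 * k : ℤ) : ℂ))) / 2 =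
        (1 + τ) / 2 + ((0 : ℤ) * τ + k) by push_cast; ring)]
  have hinj : Function.Injective fun p : ℤ × ℤ => (2 * p.1 + 1, 2 * p.2) := by
    rintro ⟨a, b⟩ ⟨c, d⟩ h
    simp only [Prod.mk.injEq] at h
    ext <;> simp <;> omega
  obtain ⟨C, hC⟩ := eventually_norm_kernel_zero_sub_le 1 one_pos 1
  have hC' := hinj.tendsto_cofinite.eventually hC
  have hk : kernel 0 2 = 4⁻¹ := by rw [kernel_zero_left]; norm_num
  -- The shift `τ/2` is unbounded at `i∞`. After doubling, the two arguments are lattice points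
  -- differing by `1`, to which the uniform cubic bound applies.
  have e (τ : ℂ) (p : ℤ × ℤ) : kernel 0 (point τ p + τ / 2) - kernel 0 (point τ p + (1 + τ) / 2) =
      -4 * (kernel 0 (point τ (2 * p.1 + 1, 2 * p.2) + 1) -
        kernel 0 (point τ (2 * p.1 + 1, 2 * p.2))) := by
    rw [show point τ (2 * p.1 + 1, 2 * p.2) + 1 = 2 * (point τ p + (1 + τ) / 2) by
      simp only [point]; push_cast; ring,
      show point τ (2 * p.1 + 1, 2 * p.2) = 2 * (point τ p + τ / 2) by
      simp only [point]; push_cast; ring, kernel_mul, kernel_mul, hk]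
    ring
  have h := tendsto_tsum_of_cofinite_bound
    (f := fun τ p => kernel 0 (point τ p + τ / 2) - kernel 0 (point τ p + (1 + τ) / 2))
    (g := fun _ : ℤ × ℤ => 0) mem_stripInfty
    (((summable_norm_int_prod (k := 3) (by norm_num)).comp_injective hinj).mul_left (4 * C))
    (fun p => ?_) ?_
  · rw [tsum_zero] at h
    refine h.congr' ?_
    filter_upwards [mem_stripInfty] with τ hτ
    have hτ' : 0 < τ.im := one_pos.trans_le hτ.2
    rw [regSum, regSum, ← (summable_kernel_sub hτ' _ (by norm_num)).tsum_sub
      (summable_kernel_sub hτ' _ (by norm_num))]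
    refine tsum_congr fun p => ?_
    ring
  · have hp : (p.1 : ℝ) + 1 / 2 ≠ 0 := by
      intro h
      have : ((2 * p.1 + 1 : ℤ) : ℝ) = 0 := by push_cast; linarith
      rw [Int.cast_eq_zero] at this
      omega
    have h1 := tendsto_kernel_zero_stripInfty hp (p.2 : ℂ)
    have h2 := tendsto_kernel_zero_stripInfty hp ((p.2 : ℂ) + 1 / 2)
    have h3 := h1.sub h2
    rw [sub_zero] at h3
    refine h3.congr fun τ => ?_
    simp only [point]
    push_cast
    ring_nf
  · filter_upwards [hC'] with p hp τ hτ
    rw [e, norm_mul, mul_assoc]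
    norm_num
    have := hp τ hτ.1 hτ.2
    simpa using this

/-! ### The theta function -/

lemma theta4_eq_jacobiTheta (τ : ℂ) : theta4 τ = jacobiTheta (τ + 1) := by
  refine tsum_congr fun n => ?_
  have h1 : cexp (Real.pi * I * (n : ℂ) ^ 2) = (-1 : ℂ) ^ n := by
    rw [show (Real.pi : ℂ) * I * (n : ℂ) ^ 2 = ((n ^ 2 : ℤ) : ℂ) * (Real.pi * I) by push_cast; ring,
      Complex.exp_int_mul, Complex.exp_pi_mul_I]
    rcases Int.even_or_odd n with h | h
    · rw [h.neg_one_zpow, (h.pow_of_ne_zero two_ne_zero).neg_one_zpow]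
    · rw [h.neg_one_zpow, h.pow.neg_one_zpow]
  rw [← h1, ← Complex.exp_add]
  ring_nf

lemma theta4_add_one (τ : ℂ) : theta4 (τ + 1) = jacobiTheta τ := by
  rw [theta4_eq_jacobiTheta, add_assoc, one_add_one_eq_two, add_comm, jacobiTheta_two_add]

lemma differentiableOn_theta4 : DifferentiableOn ℂ theta4 upperSet := by
  have : theta4 = fun τ => jacobiTheta (τ + 1) := funext theta4_eq_jacobiTheta
  rw [this]
  intro τ hτ
  have h : DifferentiableAt ℂ jacobiTheta (τ + 1) :=
    differentiableAt_jacobiTheta (by simpa using hτ)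
  exact (DifferentiableAt.comp (f := fun τ => τ + 1) τ h (by fun_prop)).differentiableWithinAt

/-- The fourth power removes the branch of the square root from the functional equation of theta. -/
lemma neg_I_mul_cpow_half_pow {τ : ℂ} : ((-I * τ) ^ (1 / 2 : ℂ)) ^ 4 = -τ ^ 2 := by
  rw [← Complex.cpow_nat_mul]
  norm_num
  rw [mul_pow, I_sq]
  ring

lemma neg_I_mul_cpow_ne_zero {τ : ℂ} (hτ : 0 < τ.im) : (-I * τ) ^ (1 / 2 : ℂ) ≠ 0 := by
  rw [Ne, cpow_eq_zero_iff, not_and_or]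
  exact Or.inl (mul_ne_zero (neg_ne_zero.mpr I_ne_zero) (ne_zero_of_im_pos hτ))

lemma jacobiTheta_neg_inv_pow {τ : ℂ} (hτ : 0 < τ.im) :
    jacobiTheta (-1 / τ) ^ 4 = -τ ^ 2 * jacobiTheta τ ^ 4 := by
  have h := jacobiTheta₂_functional_equation 0 τ
  have hn := neg_I_mul_cpow_ne_zero hτ
  rw [jacobiTheta_eq_jacobiTheta₂, jacobiTheta_eq_jacobiTheta₂, h, ← neg_I_mul_cpow_half_pow]
  simp only [zero_div, ne_eq, OfNat.ofNat_ne_zero, not_false_eq_true, zero_pow, mul_zero,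
    Complex.exp_zero]
  generalize (-I * τ) ^ (1 / 2 : ℂ) = c at hn ⊢
  field_simp

/-- The theta function `∑ q^{(n + 1/2)² / 2}`. -/
def theta2 (τ : ℂ) : ℂ := cexp (Real.pi * I * τ / 4) * jacobiTheta₂ (τ / 2) τ

lemma theta4_neg_inv_pow {τ : ℂ} (hτ : 0 < τ.im) :
    theta4 (-1 / τ) ^ 4 = -τ ^ 2 * theta2 τ ^ 4 := by
  have h := jacobiTheta₂_functional_equation (τ / 2) τ
  have hn := neg_I_mul_cpow_ne_zero hτ
  have h0 := ne_zero_of_im_pos hτ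
  have h4 : theta4 (-1 / τ) = jacobiTheta₂ (1 / 2) (-1 / τ) := by
    refine tsum_congr fun n => ?_
    have h1 : cexp (Real.pi * I * n) = (-1 : ℂ) ^ n := by
      rw [mul_comm, Complex.exp_int_mul, Complex.exp_pi_mul_I]
    rw [jacobiTheta₂_term, ← h1, ← Complex.exp_add]
    ring_nf
  rw [h4, theta2, h, ← neg_I_mul_cpow_half_pow, ← mul_pow]
  congr 1
  rw [show τ / 2 / τ = 1 / 2 by field_simp]
  rw [show -(Real.pi : ℂ) * I * (τ / 2) ^ 2 / τ = -(Real.pi * I * τ / 4) by field_simp; ring,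
    Complex.exp_neg]
  have := Complex.exp_ne_zero (Real.pi * I * τ / 4)
  generalize (-I * τ) ^ (1 / 2 : ℂ) = c at hn ⊢
  generalize cexp (Real.pi * I * τ / 4) = d at this ⊢
  field_simp

lemma tendsto_jacobiTheta : Tendsto jacobiTheta imInfty (𝓝 1) := by
  have h1 : Tendsto (fun τ : ℂ => Real.exp (-Real.pi * τ.im)) imInfty (𝓝 0) :=
    Real.tendsto_exp_atBot.comp
      (tendsto_comap.const_mul_atTop_of_neg (by linarith [Real.pi_pos]))
  have h2 := isBigO_at_im_infty_jacobiTheta_sub_one.trans_tendsto h1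
  simpa using h2.add_const 1

lemma tendsto_theta4 : Tendsto theta4 imInfty (𝓝 1) := by
  have : theta4 = fun τ => jacobiTheta (τ + 1) := funext theta4_eq_jacobiTheta
  rw [this]
  have h := tendsto_add_real_imInfty 1
  rw [ofReal_one] at h
  exact tendsto_jacobiTheta.comp h

lemma tendsto_theta2 : Tendsto theta2 imInfty (𝓝 0) := by
  -- Completing the square: the prefactor supplies the `1/4` in `(n + 1/2)² = n² + n + 1/4`.
  have hnorm (τ : ℂ) (n : ℤ) : ‖cexp (Real.pi * I * τ / 4) * jacobiTheta₂_term n (τ / 2) τ‖ =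
      Real.exp (-Real.pi * (n + 1 / 2) ^ 2 * τ.im) := by
    rw [norm_mul, norm_jacobiTheta₂_term, Complex.norm_exp, ← Real.exp_add]
    congr 1
    rw [show (Real.pi : ℂ) * I * τ / 4 = ((Real.pi / 4 : ℝ) : ℂ) * (I * τ) by push_cast; ring,
      re_ofReal_mul, I_mul_re, show τ / 2 = ((1 / 2 : ℝ) : ℂ) * τ by push_cast; ring, im_ofReal_mul]
    ring
  have hs : Summable fun n : ℤ => Real.exp (-Real.pi * ((n : ℝ) + 1 / 2) ^ 2 * 1) := by
    have := ((summable_jacobiTheta₂_term_iff (I / 2) I).mpr (by simp)).mul_left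
      (cexp (Real.pi * I * I / 4))
    refine this.norm.congr fun n => ?_
    rw [hnorm I n, I_im]
  have h := tendsto_tsum_of_dominated_convergence (𝓕 := imInfty)
    (f := fun τ (n : ℤ) => cexp (Real.pi * I * τ / 4) * jacobiTheta₂_term n (τ / 2) τ)
    (g := fun _ => 0) hs (fun n => ?_) ?_
  · rw [tsum_zero] at h
    refine h.congr fun τ => ?_
    rw [tsum_mul_left]
    rfl
  · rw [tendsto_zero_iff_norm_tendsto_zero]
    simp only [hnorm]
    refine Real.tendsto_exp_atBot.comp (tendsto_comap.const_mul_atTop_of_neg ?_)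
    have h2 : (n : ℝ) + 1 / 2 ≠ 0 := by
      intro h
      have : ((2 * n + 1 : ℤ) : ℝ) = 0 := by push_cast; linarith
      rw [Int.cast_eq_zero] at this
      omega
    have := Real.pi_pos
    have : 0 < ((n : ℝ) + 1 / 2) ^ 2 := by positivity
    nlinarith
  · filter_upwards [eventually_imInfty 1] with τ hτ n
    rw [hnorm, Real.exp_le_exp]
    have := Real.pi_pos
    have : 0 ≤ Real.pi * ((n : ℝ) + 1 / 2) ^ 2 := by positivity
    nlinarith

/-! ### Jacobi's identity for `θ₄⁴` -/

/-- `eq_zero_of_thetaGroup` applies to the difference of the sides. At `i∞`, `e₁ + e₂ + e₃ = 0`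
gives `e₁ - e₃ = (3/2) e₁ + (e₂ - e₃)/2 → π²`. Under inversion `e₁ - e₃` becomes `e₂ - e₃` and `θ₄⁴`
becomes `-θ₂⁴`, both tending to `0`. -/
theorem regSum_zero_sub_eq_theta4 {τ : ℂ} (hτ : 0 < τ.im) :
    regSum 0 τ (1 / 2) - regSum 0 τ ((1 + τ) / 2) = Real.pi ^ 2 * theta4 τ ^ 4 := by
  have hone (τ : ℂ) (hτ : 0 < τ.im) (a : ℂ) : regSum 0 (τ + 1) a = regSum 0 τ a := by
    simpa using regSum_zero_add_int hτ a 1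
  have him (τ : ℂ) (hτ : 0 < τ.im) : 0 < (τ + 1).im := by simpa using hτ
  set f : ℂ → ℂ := fun τ =>
    regSum 0 τ (1 / 2) - regSum 0 τ ((1 + τ) / 2) - Real.pi ^ 2 * theta4 τ ^ 4
  have hf1 (τ : ℂ) (hτ : 0 < τ.im) :
      f (τ + 1) = regSum 0 τ (1 / 2) - regSum 0 τ (τ / 2) - Real.pi ^ 2 * jacobiTheta τ ^ 4 := by
    simp only [f]
    rw [hone τ hτ, hone τ hτ, theta4_add_one,
      regSum_zero_shift hτ 0 1 (show (1 + (τ + 1)) / 2 = τ / 2 + ((0 : ℤ) * τ + (1 : ℤ)) by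
        push_cast; ring)]
  suffices f τ = 0 from sub_eq_zero.mp this
  refine eq_zero_of_thetaGroup ?_ ?_ ?_ ?_ ?_ hτ
  · exact (differentiableOn_regSum_zero_half.sub differentiableOn_regSum_zero_half_sum).sub
      ((differentiableOn_theta4.pow 4).const_mul _)
  · intro τ hτ
    rw [← one_add_one_eq_two, ← add_assoc, hf1 _ (him τ hτ), hone τ hτ, hone τ hτ,
      ← theta4_eq_jacobiTheta, add_comm τ 1]
  · intro τ hτ
    have h0 := ne_zero_of_im_pos hτ
    rw [hf1 _ (im_neg_one_div_pos hτ), hf1 τ hτ, regSum_zero_neg_inv hτ, regSum_zero_neg_inv hτ,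
      jacobiTheta_neg_inv_pow hτ, mul_one_div,
      show τ * (-1 / τ / 2) = -(1 / 2) by field_simp, regSum_zero_neg hτ]
    ring
  · have h1 := ((tendsto_regSum_zero_half.const_mul (3 / 2)).add
      (tendsto_regSum_zero_half_period_sub.const_mul (1 / 2))).sub
      ((tendsto_theta4.pow 4).const_mul ((Real.pi : ℂ) ^ 2))
    have h2 : (3 / 2 : ℂ) * (2 * Real.pi ^ 2 / 3) + 1 / 2 * 0 - Real.pi ^ 2 * 1 ^ 4 = 0 := by ring
    rw [h2] at h1
    refine h1.congr' ?_
    filter_upwards [eventually_imInfty 0] with τ hτ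
    have := halfPeriodSum_eq_zero hτ
    simp only [halfPeriodSum] at this
    simp only [f]
    linear_combination (1 / 2) * this
  · have h1 := tendsto_regSum_zero_half_period_sub.add
      ((tendsto_theta2.pow 4).const_mul ((Real.pi : ℂ) ^ 2))
    rw [zero_pow (by norm_num), mul_zero, add_zero] at h1
    refine h1.congr' ?_
    filter_upwards [eventually_imInfty 0] with τ hτ
    have h0 := ne_zero_of_im_pos hτ
    simp only [f]
    rw [regSum_zero_neg_inv hτ, regSum_zero_neg_inv hτ, theta4_neg_inv_pow hτ, mul_one_div,
      regSum_zero_shift hτ 0 (-1) (show τ * ((1 + -1 / τ) / 2) =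
        (1 + τ) / 2 + ((0 : ℤ) * τ + (-1 : ℤ)) by push_cast; field_simp; ring)]
    field_simp
    ring

/-! ### L-series of theta series -/

lemma kernel_sub_two (s : ℂ) {z : ℂ} (hz : z ≠ 0) {n : ℕ} (hn : normSq z = n) :
    kernel (s - 2) z = (starRingEnd ℂ) z ^ 2 / (n : ℂ) ^ s := by
  have h0 : (normSq z : ℝ) ≠ 0 := by simpa using hz
  have hn0 : (n : ℂ) ≠ 0 := by
    rw [hn] at h0
    exact_mod_cast h0
  have h1 : (n : ℂ) = z * (starRingEnd ℂ) z := by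
    rw [mul_conj, hn]
    simp
  have h2 : ((Real.log (normSq z) : ℝ) : ℂ) = log n := by
    rw [hn, ← natCast_log]
  rw [kernel, h2, Complex.cpow_def_of_ne_zero hn0, div_eq_mul_inv, ← Complex.exp_neg,
    show -(s - 2) * log n = log n + log n + -(log n * s) by ring, Complex.exp_add, Complex.exp_add,
    Complex.exp_log hn0]
  have h3 : (n : ℂ) * n * (z ^ 2)⁻¹ = (starRingEnd ℂ) z ^ 2 := by
    rw [h1]
    field_simp
  rw [← h3, mul_comm (log (n : ℂ))]
  ring

/-- By `kernel_sub_two`, grouping the lattice sum by the norm `n = |z|²` produces the Dirichlet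
series term by term. -/
lemma LSeries_thetaCoeff {τ : ℂ} (hτ : 0 < τ.im) {M : ℤ × ℤ → ℕ}
    (hM : ∀ q, normSq (point τ q) = M q) {χ : ℕ → ℂ} (hχ : ∀ n, ‖χ n‖ ≤ 1) {s : ℂ}
    (hs : 2 < s.re) :
    LSeriesSummable (fun n => thetaCoeff τ n * χ n) s ∧
      LSeries (fun n => thetaCoeff τ n * χ n) s =
        1 / 2 * ∑' q, χ (M q) * kernel (s - 2) (point τ q) := by
  have hsum : Summable fun q => χ (M q) * kernel (s - 2) (point τ q) := by
    have h := summable_kernel hτ 0 (s := s - 2) (by simpa using hs)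
    simp only [add_zero] at h
    refine Summable.of_norm_bounded h.norm fun q => ?_
    rw [norm_mul]
    exact mul_le_of_le_one_left (norm_nonneg _) (hχ _)
  have hfib := (hsum.hasSum.mul_left (1 / 2)).tsum_fiberwise M
  have hterm : (fun n => ∑' q : M ⁻¹' {n}, 1 / 2 * (χ (M q) * kernel (s - 2) (point τ q))) =
      LSeries.term (fun n => thetaCoeff τ n * χ n) s := by
    funext n
    rcases eq_or_ne n 0 with rfl | hn
    · rw [LSeries.term_zero]
      refine (tsum_congr (g := fun _ => 0) fun q => ?_).trans tsum_zero
      have hq : normSq (point τ q) = ((0 : ℕ) : ℝ) := by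
        rw [hM]
        exact congrArg Nat.cast q.2
      have hz : point τ q = 0 := normSq_eq_zero.mp (by simpa using hq)
      simp [hz]
    · rw [LSeries.term_of_ne_zero hn, thetaCoeff]
      -- `thetaCoeff` attaches `τ` to the second coordinate and `point` to the first, hence the
      -- swap.
      let e : {p : ℤ × ℤ // normSq ((p.1 : ℂ) + (p.2 : ℂ) * τ) = (n : ℝ)} ≃ M ⁻¹' {n} :=
        (Equiv.prodComm ℤ ℤ).subtypeEquiv fun p => by
          rw [Set.mem_preimage, Set.mem_singleton_iff, ← Nat.cast_inj (R := ℝ), ← hM]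
          simp [point, add_comm]
      rw [← e.tsum_eq, ← tsum_mul_left, ← tsum_mul_right, ← tsum_div_const]
      refine tsum_congr fun p => ?_
      have hMe : M (e p) = n := (e p).2
      have hp : normSq (point τ (e p)) = n := by rw [hM, hMe]
      have hz : point τ (e p) ≠ 0 := by
        intro h
        rw [h, map_zero] at hp
        exact hn (by exact_mod_cast hp.symm)
      rw [kernel_sub_two s hz hp, hMe]
      have : point τ (e p) = (p.1.1 : ℂ) + (p.1.2 : ℂ) * τ := by
        simp [e, point, add_comm]
      rw [this]
      simp
      ring
  rw [hterm] at hfib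
  exact ⟨hfib.summable, hfib.tsum_eq.trans rfl⟩

lemma sum_shiftedSum_eq_sum_regSum {ι : Type*} (t : Finset ι) {τ : ℂ} (hτ : 0 < τ.im) (w a : ι → ℂ)
    (hw : ∑ i ∈ t, w i = 0) {s : ℂ} (hs : 0 < s.re) :
    ∑ i ∈ t, w i * shiftedSum s τ (a i) = ∑ i ∈ t, w i * regSum s τ (a i) := by
  simp only [regSum_eq hτ _ hs, mul_sub, Finset.sum_sub_distrib, ← Finset.sum_mul, hw, zero_mul,
    sub_zero]

/-- A Dirichlet series given by a lattice sum whose periodic weights sum to zero. -/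
lemma hasLValue_of_weight {a : ℕ → ℂ} {v τ : ℂ} (hτ : 0 < τ.im) (N : ℕ) [NeZero N]
    (w : ℤ × ℤ → ℂ) (hw : ∀ q r : ℤ × ℤ, w (q.1 * N + r.1, q.2 * N + r.2) = w r)
    (hw0 : ∑ r : Fin N × Fin N, w ((r.1 : ℕ), (r.2 : ℕ)) = 0)
    (ha : ∀ s : ℂ, 2 < s.re → LSeriesSummable a s ∧
      LSeries a s = 1 / 2 * ∑' p, w p * kernel (s - 2) (point τ p))
    (hv : Tendsto (fun s => 1 / 2 * ∑' p, w p * kernel s (point τ p)) rightOfZero (𝓝 v)) :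
    HasLValue a 2 v := by
  set Λ : ℂ → ℂ := fun s => 1 / 2 * (kernel s N * ∑ r : Fin N × Fin N,
      w ((r.1 : ℕ), (r.2 : ℕ)) * regSum s τ (point τ ((r.1 : ℕ), (r.2 : ℕ)) / N)) with hΛ
  have hd : DifferentiableOn ℂ Λ {s | -(1 / 2) < s.re} := by
    refine ((differentiable_kernel N).differentiableOn.mul ?_).const_mul _
    exact DifferentiableOn.fun_sum fun r _ => (differentiableOn_regSum hτ _).const_mul _
  have heq (s : ℂ) (hs : 0 < s.re) : Λ s = 1 / 2 * ∑' p, w p * kernel s (point τ p) := by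
    have h := tsum_weight_kernel hτ N w hw 0 hs
    simp only [add_zero] at h
    rw [h, hΛ, sum_shiftedSum_eq_sum_regSum _ hτ _ _ hw0 hs]
  have hΛ0 : Λ 0 = v := by
    have h : Tendsto Λ rightOfZero (𝓝 (Λ 0)) := (hd.continuousOn.continuousAt (x := 0)
      ((isOpen_lt continuous_const continuous_re).mem_nhds (by norm_num))).tendsto.mono_left
      (nhdsWithin_le_nhds : rightOfZero ≤ 𝓝 0)
    exact tendsto_nhds_unique h
      (hv.congr' (eventually_rightOfZero.mono fun s hs => (heq s hs).symm))
  -- Holomorphy for `Re s > -1/2`, translated by `2`, gives the half-plane `Re s > 3/2`.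
  refine ⟨3 / 2, 2, fun s => Λ (s - 2), by norm_num, ?_, fun s hs => ?_, by simp [hΛ0]⟩
  · refine hd.comp (by fun_prop) fun s hs => ?_
    simp only [Set.mem_ofPred_eq, sub_re, re_ofNat] at hs ⊢
    linarith
  · refine ⟨(ha s hs).1, ?_⟩
    exact (heq _ (by simpa using hs)).trans (ha s hs).2.symm

/-! ### The forms of level `32`, `48`, `64`, `112` -/

/-- The weight `(-1)^m` for `n` odd, `0` for `n` even. -/
def oddWeight (p : ℤ × ℤ) : ℂ := if Even p.2 then 0 else if Even p.1 then 1 else -1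

lemma oddWeight_periodic (q r : ℤ × ℤ) :
    oddWeight (q.1 * (2 : ℕ) + r.1, q.2 * (2 : ℕ) + r.2) = oddWeight r := by
  simp [oddWeight, Int.even_add]

lemma sum_oddWeight : ∑ r : Fin 2 × Fin 2, oddWeight ((r.1 : ℕ), (r.2 : ℕ)) = 0 := by
  simp [Fintype.sum_prod_type, oddWeight]

/-- Points with `n` odd lie in `2(ℤτ + ℤ) + 1` or `2(ℤτ + ℤ) + 1 + τ`, according to the parity of
`m`. -/
lemma tsum_oddWeight {τ : ℂ} (hτ : 0 < τ.im) {s : ℂ} (hs : 0 < s.re) :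
    ∑' p, oddWeight p * kernel s (point τ p) =
      kernel s 2 * (shiftedSum s τ (1 / 2) - shiftedSum s τ ((1 + τ) / 2)) := by
  have h := tsum_weight_kernel hτ 2 oddWeight oddWeight_periodic 0 hs
  simp only [add_zero] at h
  rw [h]
  simp [Fintype.sum_prod_type, oddWeight, point]
  left
  rw [add_comm τ 1]
  ring

lemma tendsto_tsum_oddWeight {τ : ℂ} (hτ : 0 < τ.im) :
    Tendsto (fun s => 1 / 2 * ∑' p, oddWeight p * kernel s (point τ p)) rightOfZero
      (𝓝 (Real.pi ^ 2 / 8 * theta4 τ ^ 4)) := by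
  have h := (((tendsto_kernel 2).mul ((tendsto_regSum hτ (1 / 2)).sub
    (tendsto_regSum hτ ((1 + τ) / 2))))).const_mul (1 / 2)
  rw [regSum_zero_sub_eq_theta4 hτ] at h
  have e : (1 / 2 : ℂ) * ((2 ^ 2)⁻¹ * (Real.pi ^ 2 * theta4 τ ^ 4)) =
      Real.pi ^ 2 / 8 * theta4 τ ^ 4 := by ring
  rw [e] at h
  refine h.congr' (eventually_rightOfZero.mono fun s hs => ?_)
  simp only [tsum_oddWeight hτ hs, regSum_eq hτ _ hs]
  ring

lemma hasLValue_of_oddWeight {a : ℕ → ℂ} {τ : ℂ} (hτ : 0 < τ.im)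
    (ha : ∀ s : ℂ, 2 < s.re → LSeriesSummable a s ∧
      LSeries a s = 1 / 2 * ∑' p, oddWeight p * kernel (s - 2) (point τ p)) :
    HasLValue a 2 (Real.pi ^ 2 / 8 * theta4 τ ^ 4) :=
  hasLValue_of_weight hτ 2 oddWeight oddWeight_periodic sum_oddWeight ha (tendsto_tsum_oddWeight hτ)

/-- The weight `oddWeight` on residue classes modulo an even number. -/
def oddWeightZMod (N : ℕ) (x y : ZMod N) : ℤ :=
  if y.val % 2 = 0 then 0 else if x.val % 2 = 0 then 1 else -1

lemma oddWeight_eq {N : ℕ} [NeZero N] (hN : 2 ∣ N) (p : ℤ × ℤ) :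
    oddWeight p = (oddWeightZMod N p.1 p.2 : ℂ) := by
  have h (m : ℤ) : Even m ↔ (m : ZMod N).val % 2 = 0 := by
    have h1 := ZMod.val_intCast (n := N) m
    have h2 := Int.emod_emod_of_dvd m (show (2 : ℤ) ∣ N by exact_mod_cast hN)
    rw [Int.even_iff]
    omega
  simp only [oddWeight, oddWeightZMod, h]
  split_ifs <;> simp

lemma toNat_cast_zmod (N : ℕ) {x : ℤ} (hx : 0 ≤ x) : ((x.toNat : ℕ) : ZMod N) = (x : ZMod N) := by
  rw [← Int.cast_natCast, Int.toNat_of_nonneg hx]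

lemma chiNeg4_apply (x : ZMod 4) : chiNeg4 x = ((ZMod.χ₄ x : ℤ) : ℂ) := rfl

lemma chiNeg8_apply (x : ZMod 8) : chiNeg8 x = ((ZMod.χ₈' x : ℤ) : ℂ) := rfl

lemma chiNeg3_apply (x : ZMod 3) : chiNeg3 x = ((quadraticChar (ZMod 3) x : ℤ) : ℂ) := rfl

lemma LSeries_twist {τ : ℂ} (hτ : 0 < τ.im) {N : ℕ} (χ : DirichletCharacter ℂ N)
    {Q : ℤ × ℤ → ℤ} (hQ : ∀ q, normSq (point τ q) = Q q) {w : ℤ × ℤ → ℂ}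
    (hw : ∀ q, χ ((Q q : ℤ) : ZMod N) = w q) {s : ℂ} (hs : 2 < s.re) :
    LSeriesSummable (twist (thetaCoeff τ) χ) s ∧
      LSeries (twist (thetaCoeff τ) χ) s = 1 / 2 * ∑' q, w q * kernel (s - 2) (point τ q) := by
  have hpos (q : ℤ × ℤ) : 0 ≤ Q q := by
    have := normSq_nonneg (point τ q)
    rw [hQ] at this
    exact_mod_cast this
  have h := LSeries_thetaCoeff hτ (M := fun q => (Q q).toNat) (fun q => by
    rw [hQ, ← Int.cast_natCast, Int.toNat_of_nonneg (hpos q)])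
    (χ := fun n => χ (n : ZMod N)) (fun n => χ.norm_le_one _) hs
  simp only [toNat_cast_zmod N (hpos _), hw] at h
  exact h

lemma normSq_point_I_mul (x : ℝ) (q : ℤ × ℤ) :
    normSq (point (I * x) q) = x ^ 2 * q.1 ^ 2 + q.2 ^ 2 := by
  simp [point, normSq_apply]
  ring

/-- For `n` odd, `2m² + n²` is `1` or `3` modulo `4` according to the parity of `m`. -/
theorem hasLValue_f32 : HasLValue f32 2 (Real.pi ^ 2 / 8 * theta4 (I * (√2 : ℝ)) ^ 4) := by
  have hτ : 0 < (I * (√2 : ℝ)).im := by simp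
  refine hasLValue_of_oddWeight hτ fun s hs => LSeries_twist hτ chiNeg4
    (Q := fun q => 2 * q.1 ^ 2 + q.2 ^ 2) (fun q => ?_) (fun q => ?_) hs
  · rw [normSq_point_I_mul, Real.sq_sqrt (by norm_num)]
    push_cast
    ring
  · have h : ∀ x y : ZMod 4, ZMod.χ₄ (2 * x ^ 2 + y ^ 2) = oddWeightZMod 4 x y := by decide
    rw [chiNeg4_apply, oddWeight_eq (N := 4) (by norm_num), ← h]
    push_cast
    rfl

/-- For `n` odd, `4m² + n²` is `1` or `5` modulo `8`, and `χ_{-8}(5) = -1`. -/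
theorem hasLValue_f64 : HasLValue f64 2 (Real.pi ^ 2 / 8 * theta4 (2 * I) ^ 4) := by
  have hτ : 0 < (2 * I).im := by simp
  refine hasLValue_of_oddWeight hτ fun s hs => LSeries_twist hτ chiNeg8
    (Q := fun q => 4 * q.1 ^ 2 + q.2 ^ 2) (fun q => ?_) (fun q => ?_) hs
  · rw [mul_comm, show (2 : ℂ) = (2 : ℝ) by norm_num, normSq_point_I_mul]
    push_cast
    ring
  · have h : ∀ x y : ZMod 8, ZMod.χ₈' (4 * x ^ 2 + y ^ 2) = oddWeightZMod 8 x y := by decide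
    rw [chiNeg8_apply, oddWeight_eq (N := 8) (by norm_num), ← h]
    push_cast
    rfl

lemma zeta3_eq : zeta3 = (-1 + I * (√3 : ℝ)) / 2 := by
  rw [zeta3, show 2 * (Real.pi : ℂ) * I / 3 = ((Real.pi - Real.pi / 3 : ℝ) : ℂ) * I by
    push_cast; ring, Complex.exp_mul_I, ← ofReal_cos, ← ofReal_sin, Real.cos_pi_sub,
    Real.sin_pi_sub, Real.cos_pi_div_three, Real.sin_pi_div_three]
  push_cast
  ring

lemma zeta3_im_pos : 0 < zeta3.im := by
  rw [zeta3_eq]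
  simp

/-- As `√-3 = 2ζ₃ + 1`, a shear takes `ℤ√-3 + ℤ` to `ℤ·2ζ₃ + ℤ` and the twisting character to
`oddWeight`. -/
theorem hasLValue_f48 : HasLValue f48 2 (Real.pi ^ 2 / 8 * theta4 (2 * zeta3) ^ 4) := by
  have hτ : 0 < (I * (√3 : ℝ)).im := by simp
  refine hasLValue_of_oddWeight (by simpa using zeta3_im_pos) fun s hs => ?_
  have h := LSeries_twist hτ chiNeg4 (Q := fun q => 3 * q.1 ^ 2 + q.2 ^ 2)
    (w := fun q => oddWeight (shearEquiv 1 q)) (fun q => ?_) (fun q => ?_) hs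
  · refine ⟨h.1, h.2.trans ?_⟩
    rw [← (shearEquiv 1).tsum_eq fun p => oddWeight p * kernel (s - 2) (point (2 * zeta3) p)]
    simp only [point_shearEquiv]
    rw [zeta3_eq]
    congr! 6
    push_cast
    ring
  · rw [normSq_point_I_mul, Real.sq_sqrt (by norm_num)]
    push_cast
    ring
  · have h : ∀ x y : ZMod 4, ZMod.χ₄ (3 * x ^ 2 + y ^ 2) = oddWeightZMod 4 x (y + x) := by decide
    rw [chiNeg4_apply, oddWeight_eq (N := 4) (by norm_num)]
    simp only [shearEquiv, Equiv.coe_fn_mk, one_mul]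
    push_cast
    rw [← h]

lemma tau7_im_pos : 0 < tau7.im := by
  simp [tau7]

/-- For `m` odd the norm `n² + mn + 2m²` is even and the character kills it. Even `m` leave the
lattice of `2τ₇ = 1 + √-7`, where `n² + 2mn + 8m² ≡ 1 + 2m` modulo `4` for `n` odd. -/
theorem hasLValue_f112 :
    HasLValue f112 2 (Real.pi ^ 2 / 8 * theta4 (1 + I * (√7 : ℝ)) ^ 4) := by
  refine hasLValue_of_oddWeight (by simp) fun s hs => ?_
  set w : ℤ × ℤ → ℂ := fun q => if (2 : ℤ) ∣ q.1 then oddWeight (q.1 / 2, q.2) else 0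
  have h := LSeries_twist tau7_im_pos chiNeg4 (Q := fun q => q.2 ^ 2 + q.1 * q.2 + 2 * q.1 ^ 2)
    (w := w) (fun q => ?_) (fun q => ?_) hs
  · refine ⟨h.1, h.2.trans ?_⟩
    congr 1
    have h1 := tsum_dvd_fst (fun q => oddWeight (q.1 / 2, q.2) * kernel (s - 2) (point tau7 q)) 2
    rw [show ∑' q, w q * kernel (s - 2) (point tau7 q) = _ from
      tsum_congr fun q => by
        rw [show w q = (if ((2 : ℕ) : ℤ) ∣ q.1 then 1 else 0) * oddWeight (q.1 / 2, q.2) by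
          simp [w], mul_assoc], h1]
    refine tsum_congr fun q => ?_
    congr 2
    · simp
    · simp only [point, tau7]
      push_cast
      ring
  · have h7 : (√7 : ℝ) ^ 2 = 7 := Real.sq_sqrt (by norm_num)
    simp [point, tau7, normSq_apply]
    linear_combination (q.1 ^ 2 / 4 : ℝ) * h7
  · rw [chiNeg4_apply]
    simp only [w]
    split_ifs with hq
    · obtain ⟨k, hk⟩ := hq
      have h : ∀ x y : ZMod 4, ZMod.χ₄ (y ^ 2 + 2 * x * y + 2 * (2 * x) ^ 2) =
        oddWeightZMod 4 x y := by decide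
      rw [oddWeight_eq (N := 4) (by norm_num), hk, Int.mul_ediv_cancel_left k two_ne_zero, ← h]
      push_cast
      rfl
    · obtain ⟨k, hk⟩ : Odd q.1 := by
        rwa [← Int.not_even_iff_odd, even_iff_two_dvd]
      have h : ∀ x y : ZMod 4, ZMod.χ₄ (y ^ 2 + (2 * x + 1) * y + 2 * (2 * x + 1) ^ 2) = 0 := by
        decide
      have h2 := h k q.2
      rw [hk]
      push_cast
      rw [h2, Int.cast_zero]

/-- `E(2τ) - 4⁻¹ E(τ/2)` at `s = 0`. -/
theorem G2level_four_eq {τ : ℂ} (hτ : 0 < τ.im) :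
    1 / 4 * G2level 4 (τ / 2) = Real.pi ^ 2 / 8 * theta4 (1 + τ) ^ 4 := by
  have hτ1 : 0 < (1 + τ).im := by simpa using hτ
  have h1 := tendsto_tsum_oddWeight hτ1
  have h2 := ((tendsto_shiftedSum_zero (τ := 2 * τ) (by simpa using hτ)).sub
    ((tendsto_kernel 2).mul (tendsto_shiftedSum_zero (τ := τ / 2) (by simpa using hτ)))).const_mul
    (1 / 2)
  have h3 := tendsto_nhds_unique h2 (h1.congr' (eventually_rightOfZero.mono fun s hs => ?_))
  · rw [← h3, G2level]
    push_cast
    rw [show (4 : ℂ) * (τ / 2) = 2 * τ by ring]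
    ring
  · have e1 := shiftedSum_nat_mul 2 hτ 0 hs
    have e2 := shiftedSum_div_nat 2 hτ 0 hs
    have e3 := shiftedSum_add_int s τ (1 / 2) 1
    have e4 := shiftedSum_add_int s τ (τ / 2) 1
    have e5 := shiftedSum_congr (s := s) (τ := 1 + τ) (a := τ / 2) (b := (1 + (1 + τ)) / 2) 0 1
      (by push_cast; ring)
    simp only [Fin.sum_univ_two, Nat.cast_ofNat, Fin.val_zero, Fin.val_one, Nat.cast_zero,
      Nat.cast_one, add_zero, zero_div, zero_mul, one_mul, zero_add] at e1 e2
    rw [Int.cast_one, add_comm τ 1] at e3 e4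
    simp only [tsum_oddWeight hτ1 hs, e5, e3, e4, e1, e2]
    ring

/-! ### Lattice sums with weights modulo 3 -/

lemma tsum_weight_three {τ : ℂ} (hτ : 0 < τ.im) (w : ℤ × ℤ → ℂ)
    (hw : ∀ q r : ℤ × ℤ, w (q.1 * (3 : ℕ) + r.1, q.2 * (3 : ℕ) + r.2) = w r) {s : ℂ}
    (hs : 0 < s.re) :
    ∑' p, w p * kernel s (point τ p) = kernel s 3 *
      (w (0, 0) * shiftedSum s τ 0 + w (0, 1) * shiftedSum s τ (1 / 3) +
        w (0, 2) * shiftedSum s τ (2 / 3) + w (1, 0) * shiftedSum s τ (τ / 3) +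
        w (1, 1) * shiftedSum s τ ((τ + 1) / 3) + w (1, 2) * shiftedSum s τ ((τ + 2) / 3) +
        w (2, 0) * shiftedSum s τ (2 * τ / 3) + w (2, 1) * shiftedSum s τ ((2 * τ + 1) / 3) +
        w (2, 2) * shiftedSum s τ ((2 * τ + 2) / 3)) := by
  have h := tsum_weight_kernel hτ 3 w hw 0 hs
  simp only [add_zero] at h
  rw [h, Fintype.sum_prod_type]
  simp only [Fin.sum_univ_three, point, Fin.val_zero, Fin.val_one, Fin.val_two, Nat.cast_zero,
    Nat.cast_one, Nat.cast_ofNat, Int.cast_zero, Int.cast_one, Int.cast_ofNat, zero_mul, zero_add,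
    one_mul, add_zero, zero_div]
  ring

lemma shiftedSum_three_mul {τ : ℂ} (hτ : 0 < τ.im) {s : ℂ} (hs : 0 < s.re) :
    shiftedSum s (3 * τ) 0 = kernel s 3 *
      (shiftedSum s τ 0 + shiftedSum s τ (1 / 3) + shiftedSum s τ (2 / 3)) := by
  have h := shiftedSum_nat_mul 3 hτ 0 hs
  simpa only [Fin.sum_univ_three, Fin.val_zero, Fin.val_one, Fin.val_two, Nat.cast_zero,
    Nat.cast_one, Nat.cast_ofNat, add_zero, zero_div] using h

lemma shiftedSum_div_three {τ : ℂ} (hτ : 0 < τ.im) {s : ℂ} (hs : 0 < s.re) :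
    shiftedSum s (τ / 3) 0 =
      shiftedSum s τ 0 + shiftedSum s τ (τ / 3) + shiftedSum s τ (2 * τ / 3) := by
  have h := shiftedSum_div_nat 3 hτ 0 hs
  simpa only [Fin.sum_univ_three, Fin.val_zero, Fin.val_one, Fin.val_two, Nat.cast_zero,
    Nat.cast_one, Nat.cast_ofNat, zero_add, zero_div, zero_mul, one_mul] using h

lemma shiftedSum_eq_sum_three {τ : ℂ} (hτ : 0 < τ.im) {s : ℂ} (hs : 0 < s.re) :
    shiftedSum s τ 0 = kernel s 3 *
      (shiftedSum s τ 0 + shiftedSum s τ (1 / 3) + shiftedSum s τ (2 / 3) +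
        shiftedSum s τ (τ / 3) + shiftedSum s τ ((τ + 1) / 3) + shiftedSum s τ ((τ + 2) / 3) +
        shiftedSum s τ (2 * τ / 3) + shiftedSum s τ ((2 * τ + 1) / 3) +
        shiftedSum s τ ((2 * τ + 2) / 3)) := by
  have h := tsum_weight_three hτ 1 (fun _ _ => rfl) hs
  simp only [Pi.one_apply, one_mul] at h
  rw [← h]
  simp [shiftedSum]

/-! ### The form of level `27` -/

lemma zeta3_sq : zeta3 ^ 2 = -1 - zeta3 := by
  have h3 : ((√3 : ℝ) : ℂ) ^ 2 = 3 := by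
    rw [← ofReal_pow, Real.sq_sqrt (by norm_num)]
    norm_num
  rw [zeta3_eq]
  linear_combination (I ^ 2 / 4) * h3 + (3 / 4 : ℂ) * I_sq

lemma normSq_zeta3 : normSq zeta3 = 1 := by
  have h3 : (√3 : ℝ) * √3 = 3 := Real.mul_self_sqrt (by norm_num)
  rw [zeta3_eq, normSq_apply]
  simp
  linear_combination h3 / 4

/-- The Eisenstein series vanishes at a point fixed by an element acting with nontrivial factor. -/
lemma shiftedSum_zero_eq_zero_of_fixed {τ : ℂ} (hτ : 0 < τ.im) (k : ℤ) (h : -1 / τ = τ + k)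
    (hn : normSq τ = 1) (h2 : τ ^ 2 ≠ 1) (s : ℂ) : shiftedSum s τ 0 = 0 := by
  have h1 := shiftedSum_neg_inv s (ne_zero_of_im_pos hτ) 0
  rw [h, shiftedSum_add_int, mul_zero] at h1
  -- Because `|τ| = 1`, the automorphy factor is `τ²` for every `s`, not only at `s = 0`.
  have hk : kernel s τ⁻¹ = τ ^ 2 := by
    rw [kernel, normSq_inv, hn]
    simp
  rw [hk] at h1
  have : (τ ^ 2 - 1) * shiftedSum s τ 0 = 0 := by linear_combination -h1
  exact (mul_eq_zero.mp this).resolve_left (sub_ne_zero.mpr h2)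

lemma shiftedSum_zeta3 (s : ℂ) : shiftedSum s zeta3 0 = 0 := by
  have h0 := ne_zero_of_im_pos zeta3_im_pos
  refine shiftedSum_zero_eq_zero_of_fixed zeta3_im_pos 1 ?_ normSq_zeta3 ?_ s
  · rw [div_eq_iff h0]
    push_cast
    linear_combination -zeta3_sq
  · rw [zeta3_sq]
    intro h
    have := congrArg im h
    simp at this
    exact zeta3_im_pos.ne' this

lemma shiftedSum_I (s : ℂ) : shiftedSum s I 0 = 0 := by
  refine shiftedSum_zero_eq_zero_of_fixed (by simp) 0 ?_ (by simp) ?_ s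
  · rw [div_eq_iff I_ne_zero]
    simp
  · rw [I_sq]
    norm_num

lemma G2star_eq_zero {τ : ℂ} (hτ : 0 < τ.im) (h : ∀ s, shiftedSum s τ 0 = 0) : G2star τ = 0 := by
  have h1 := tendsto_shiftedSum_zero hτ
  simp only [h] at h1
  have := tendsto_nhds_unique h1 tendsto_const_nhds
  simpa using this

lemma tau27_eq : tau27 = 3 * zeta3 + (2 : ℤ) := by
  have h : √27 = 3 * √3 := by
    rw [show (27 : ℝ) = 3 ^ 2 * 3 by norm_num, Real.sqrt_mul (by norm_num),
      Real.sqrt_sq (by norm_num)]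
  rw [tau27, zeta3_eq, h]
  push_cast
  ring

theorem hasLValue_f27 : HasLValue f27 2 (1 / 3 * G2level 3 zeta3) := by
  have hτ : 0 < tau27.im := by simp [tau27]
  have h3 : 0 < (3 * zeta3).im := by simpa using zeta3_im_pos
  -- Subtracting `1/3` costs nothing, the full sum over `ℤζ₃ + ℤ` being `0`, and makes the nine
  -- weights sum to `0`.
  set w : ℤ × ℤ → ℂ := fun q => (if ((3 : ℕ) : ℤ) ∣ q.1 then 1 else 0) - 1 / 3
  have hw : ∀ q r : ℤ × ℤ, w (q.1 * (3 : ℕ) + r.1, q.2 * (3 : ℕ) + r.2) = w r := fun q r => by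
    simp [w]
  have hsum (s : ℂ) (hs : 0 < s.re) :
      ∑' p, w p * kernel s (point zeta3 p) = shiftedSum s (3 * zeta3) 0 := by
    have h1 := shiftedSum_eq_sum_three zeta3_im_pos hs
    rw [tsum_weight_three zeta3_im_pos w hw hs, shiftedSum_three_mul zeta3_im_pos hs]
    have w0 (k : ℤ) : w (0, k) = 2 / 3 := by norm_num [w]
    have w1 (k : ℤ) : w (1, k) = -1 / 3 := by norm_num [w]
    have w2 (k : ℤ) : w (2, k) = -1 / 3 := by norm_num [w]
    simp only [w0, w1, w2, shiftedSum_zeta3] at h1 ⊢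
    linear_combination (1 / 3 : ℂ) * h1
  refine hasLValue_of_weight zeta3_im_pos 3 w hw ?_ (fun s hs => ?_) ?_
  · rw [Fintype.sum_prod_type]
    simp only [Fin.sum_univ_three]
    norm_num [w]
  · have h := LSeries_thetaCoeff hτ (M := fun q => (q.2 ^ 2 + q.1 * q.2 + 7 * q.1 ^ 2).toNat)
      (fun q => ?_) (χ := fun _ => 1) (fun n => by simp) hs
    · simp only [mul_one, one_mul] at h
      refine ⟨h.1, h.2.trans ?_⟩
      rw [hsum _ (by simpa using hs), ← shiftedSum_add_int _ _ _ 2, ← tau27_eq, shiftedSum]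
      simp only [add_zero]
    · have hnn : 0 ≤ q.2 ^ 2 + q.1 * q.2 + 7 * q.1 ^ 2 := by
        nlinarith [sq_nonneg (q.1 + q.2), sq_nonneg q.1, sq_nonneg q.2]
      rw [← Int.cast_natCast, Int.toNat_of_nonneg hnn]
      have h27 : (√27 : ℝ) ^ 2 = 27 := Real.sq_sqrt (by norm_num)
      simp [point, tau27, normSq_apply]
      linear_combination (q.1 ^ 2 / 4 : ℝ) * h27
  · have h := (tendsto_shiftedSum_zero h3).const_mul (1 / 2)
    rw [show (1 / 3 : ℂ) * G2level 3 zeta3 = 1 / 2 * (2 * G2star (3 * zeta3)) by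
      rw [G2level, G2star_eq_zero zeta3_im_pos shiftedSum_zeta3]
      push_cast
      ring]
    exact h.congr' (eventually_rightOfZero.mono fun s hs => by simp only [hsum s hs])

/-! ### The form of level `144` -/

/-- The residue weight of the quadratic character modulo `3` of `4m² + n²`. -/
def weight144 (p : ℤ × ℤ) : ℂ :=
  2 * (if (3 : ℤ) ∣ p.1 then 1 else 0) + 2 * (if (3 : ℤ) ∣ p.2 then 1 else 0) - 1 -
    3 * (if (3 : ℤ) ∣ p.1 ∧ (3 : ℤ) ∣ p.2 then 1 else 0)

lemma weight144_periodic (q r : ℤ × ℤ) :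
    weight144 (q.1 * (3 : ℕ) + r.1, q.2 * (3 : ℕ) + r.2) = weight144 r := by
  simp [weight144]

/-- The points with `3 ∣ m` form the lattice of `3τ`, those with `3 ∣ n` form `3` times the lattice
of `τ/3`, and those with both form `3` times the lattice of `τ`. -/
lemma tsum_weight144 {τ : ℂ} (hτ : 0 < τ.im) {s : ℂ} (hs : 0 < s.re) :
    ∑' p, weight144 p * kernel s (point τ p) =
      2 * shiftedSum s (3 * τ) 0 + kernel s 3 * (2 * shiftedSum s (τ / 3) 0) -
        (1 + 3 * kernel s 3) * shiftedSum s τ 0 := by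
  have h1 := shiftedSum_eq_sum_three hτ hs
  rw [tsum_weight_three hτ weight144 weight144_periodic hs, shiftedSum_three_mul hτ hs,
    shiftedSum_div_three hτ hs]
  norm_num [weight144] at h1 ⊢
  linear_combination h1

theorem hasLValue_f144 : HasLValue f144 2
    (2 * G2star (6 * I) + 2 / 9 * G2star (2 * I / 3) - 4 / 3 * G2star (2 * I)) := by
  have hτ : 0 < (2 * I).im := by simp
  have hτ' : 0 < tau16.im := hτ
  refine hasLValue_of_weight hτ 3 weight144 weight144_periodic ?_ (fun s hs =>
    LSeries_twist hτ' chiNeg3 (Q := fun q => 4 * q.1 ^ 2 + q.2 ^ 2) (fun q => ?_) (fun q => ?_) hs)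
    ?_
  · simp [Fintype.sum_prod_type, Fin.sum_univ_three, weight144]
    norm_num
  · rw [tau16, mul_comm, show (2 : ℂ) = (2 : ℝ) by norm_num, normSq_point_I_mul]
    push_cast
    ring
  · have h : ∀ x y : ZMod 3, quadraticChar (ZMod 3) (4 * x ^ 2 + y ^ 2) =
        2 * (if x = 0 then 1 else 0) + 2 * (if y = 0 then 1 else 0) - 1 -
          3 * (if x = 0 ∧ y = 0 then 1 else 0) := by decide
    have h3 (m : ℤ) : (3 : ℤ) ∣ m ↔ (m : ZMod 3) = 0 :=
      (ZMod.intCast_zmod_eq_zero_iff_dvd m 3).symm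
    rw [chiNeg3_apply]
    push_cast
    rw [h, weight144]
    simp only [h3]
    push_cast
    rfl
  · have t (c : ℂ) (hc : 0 < c.im) := tendsto_shiftedSum_zero hc
    have h := (((t (3 * (2 * I)) (by simp)).const_mul 2).add ((tendsto_kernel 3).mul
      ((t (2 * I / 3) (by simp)).const_mul 2))).sub
      ((tendsto_const_nhds (x := (1 : ℂ))).add ((tendsto_kernel 3).const_mul 3) |>.mul (t _ hτ))
    have h' := (h.const_mul (1 / 2)).congr' (eventually_rightOfZero.mono fun s hs => by
      rw [← tsum_weight144 hτ hs])
    refine h'.trans_eq ?_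
    congr 1
    rw [show (3 : ℂ) * (2 * I) = 6 * I by ring]
    ring

lemma G2star_I : G2star I = 0 := G2star_eq_zero (by simp) shiftedSum_I

lemma G2star_neg_inv {τ : ℂ} (hτ : 0 < τ.im) : G2star (-1 / τ) = τ ^ 2 * G2star τ := by
  have h1 := tendsto_shiftedSum_zero (im_neg_one_div_pos hτ)
  have h2 := (tendsto_kernel τ⁻¹).mul (tendsto_shiftedSum_zero hτ)
  have h3 := tendsto_nhds_unique h1 (h2.congr fun s => by
    rw [shiftedSum_neg_inv s (ne_zero_of_im_pos hτ), mul_zero])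
  rw [inv_pow, inv_inv] at h3
  linear_combination (1 / 2 : ℂ) * h3

/-- `G_2^*(i) = 0`, and `G_2^*(i/3) = -9 G_2^*(3i)` makes the terms at `3i` and `i/3` cancel. -/
lemma G2level_two_combination :
    -(2 / 3) * G2level 2 I + G2level 2 (3 * I) + 1 / 9 * G2level 2 (I / 3) =
      2 * G2star (6 * I) + 2 / 9 * G2star (2 * I / 3) - 4 / 3 * G2star (2 * I) := by
  have h := G2star_neg_inv (τ := 3 * I) (by simp)
  rw [show -1 / (3 * I) = I / 3 by
    rw [div_eq_iff (by simp)]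
    linear_combination -I_sq, mul_pow, I_sq] at h
  simp only [G2level, G2star_I, h]
  push_cast
  rw [show (2 : ℂ) * (3 * I) = 6 * I by ring, show 2 * (I / 3) = 2 * I / 3 by ring]
  ring

/-! ### Translation by a half-period -/

/-- An even analytic function vanishing at `0` is divisible by `z²`. -/
lemma exists_eq_sq_mul_of_even {g : ℂ → ℂ} (hg : AnalyticAt ℂ g 0) (h0 : g 0 = 0)
    (heven : ∀ z, g (-z) = g z) :
    ∃ k : ℂ → ℂ, AnalyticAt ℂ k 0 ∧ ∀ z, g z = z ^ 2 * k z := by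
  have hd : deriv g 0 = 0 := by
    have h := deriv_comp_neg (f := g) (x := (0 : ℂ))
    rw [neg_zero, funext heven] at h
    exact self_eq_neg.mp h
  obtain ⟨p, hp⟩ := hg
  have h1 := hp.has_fpower_series_dslope_fslope
  refine ⟨dslope (dslope g 0) 0, h1.has_fpower_series_dslope_fslope.analyticAt, fun z => ?_⟩
  have e1 := sub_smul_dslope g 0 z
  have e2 := sub_smul_dslope (dslope g 0) 0 z
  rw [dslope_same, hd] at e2
  simp only [sub_zero, smul_eq_mul, h0] at e1 e2
  linear_combination -e1 - z * e2

/-- `(℘(z + a) - ℘(a)) (℘(z) - ℘(a))` is constant for a half-period `a`. -/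
lemma exists_weierstrassP_half_period_mul (L : PeriodPair) {a : ℂ} (ha : a ∉ L.lattice)
    (h2a : 2 * a ∈ L.lattice) :
    ∃ c, ∀ z, z ∉ L.lattice → z + a ∉ L.lattice →
      (L.weierstrassP (z + a) - L.weierstrassP a) * (L.weierstrassP z - L.weierstrassP a) = c := by
  classical
  have hper (z w : ℂ) (hw : w ∈ L.lattice) : L.weierstrassP (z + w) = L.weierstrassP z :=
    L.weierstrassP_add_coe z ⟨w, hw⟩
  have hmem (z w : ℂ) (hw : w ∈ L.lattice) : z + w ∈ L.lattice ↔ z ∈ L.lattice :=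
    add_mem_cancel_right hw
  set g : ℂ → ℂ := fun z => L.weierstrassP (z + a) - L.weierstrassP a
  have hg : AnalyticAt ℂ g 0 := by
    have h := L.analyticOnNhd_weierstrassP a ha
    rw [← zero_add a] at h
    exact (h.fun_comp (f := fun z => z + a) (by fun_prop)).sub analyticAt_const
  -- Evenness of `g` comes from `2a` being a period; the resulting double zero cancels the double
  -- pole of `℘` at `0`.
  obtain ⟨k, hk, hgk⟩ := exists_eq_sq_mul_of_even hg (by simp [g]) fun z => by
    simp only [g]
    rw [← L.weierstrassP_neg (-z + a), ← hper (-(-z + a)) _ h2a]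
    ring_nf
  -- The value `k 0` fills the removable singularities. Invariance of `F` under `a` and the lattice
  -- reduces them all to `0`, and an entire periodic function is constant by Liouville.
  set F : ℂ → ℂ := fun z => if z ∈ L.lattice ∨ z + a ∈ L.lattice then k 0 else
    (L.weierstrassP (z + a) - L.weierstrassP a) * (L.weierstrassP z - L.weierstrassP a)
  have hFper (z w : ℂ) (hw : w ∈ L.lattice) : F (z + w) = F z := by
    simp only [F, hmem z w hw, hper z w hw, add_right_comm z w a, hmem (z + a) w hw,
      hper (z + a) w hw]
  have hFa (z : ℂ) : F (z + a) = F z := by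
    have e : z + a + a = z + 2 * a := by ring
    simp only [F, e, hmem z _ h2a, hper z _ h2a]
    simp only [or_comm, mul_comm]
  have hF0 : AnalyticAt ℂ F 0 := by
    have h : AnalyticAt ℂ (fun z => k z + g z * (L.weierstrassPExcept 0 z - L.weierstrassP a)) 0 :=
      hk.add (hg.mul ((L.analyticAt_weierstrassPExcept 0).sub analyticAt_const))
    refine h.congr ?_
    have h1 : ∀ᶠ z in 𝓝 (0 : ℂ), z + a ∉ L.lattice := by
      have hc : Tendsto (fun z : ℂ => z + a) (𝓝 0) (𝓝 a) := by
        have : Continuous fun z : ℂ => z + a := by fun_prop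
        simpa using this.tendsto 0
      exact hc.eventually (L.isClosed_lattice.isOpen_compl.mem_nhds ha)
    filter_upwards [h1, L.compl_lattice_sdiff_singleton_mem_nhds 0] with z hz1 hz2
    rcases eq_or_ne z 0 with rfl | hz
    · simp [F, g]
    have hz3 : z ∉ L.lattice := fun h => hz2 ⟨h, hz⟩
    have e := L.weierstrassPExcept_add 0 z
    simp only [ZeroMemClass.coe_zero, sub_zero, ne_eq, OfNat.ofNat_ne_zero, not_false_eq_true,
      zero_pow, div_zero] at e
    simp only [F, hz1, hz3, or_self, if_false]
    rw [← e]
    have := hgk z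
    simp only [g] at this ⊢
    rw [this]
    field_simp
    ring
  have hFz (z : ℂ) : AnalyticAt ℂ F z := by
    have key (w : ℂ) (hw : ∀ z, F (z + w) = F z) (hz : z + w = 0) : AnalyticAt ℂ F z := by
      rw [← hz] at hF0
      exact (hF0.fun_comp (f := fun z => z + w) (by fun_prop)).congr
        (Eventually.of_forall fun x => hw x)
    by_cases h1 : z ∈ L.lattice
    · exact key (-z) (fun x => hFper x _ (neg_mem h1)) (by ring)
    by_cases h2 : z + a ∈ L.lattice
    · refine key (a + -(z + a)) (fun x => ?_) (by ring)
      rw [← add_assoc, hFper _ _ (neg_mem h2), hFa]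
    · have a1 := L.analyticOnNhd_weierstrassP z h1
      have a2 := (L.analyticOnNhd_weierstrassP (z + a) h2).fun_comp (f := fun z => z + a)
        (by fun_prop)
      have a3 : AnalyticAt ℂ (fun x => (L.weierstrassP (x + a) - L.weierstrassP a) *
          (L.weierstrassP x - L.weierstrassP a)) z :=
        (a2.sub analyticAt_const).mul (a1.sub analyticAt_const)
      refine a3.congr ?_
      have hc : Tendsto (fun z : ℂ => z + a) (𝓝 z) (𝓝 (z + a)) := by
        have : Continuous fun z : ℂ => z + a := by fun_prop
        exact this.tendsto z
      filter_upwards [L.isClosed_lattice.isOpen_compl.mem_nhds h1,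
        hc.eventually (L.isClosed_lattice.isOpen_compl.mem_nhds h2)] with x hx1 hx2
      have hx1' : x ∉ L.lattice := hx1
      have hx2' : x + a ∉ L.lattice := hx2
      simp [F, hx1', hx2']
  have hD : Differentiable ℂ F := fun z => (hFz z).differentiableAt
  have hb := (IsZLattice.isCompact_range_of_periodic L.lattice F hD.continuous
    fun z w hw => hFper z w hw).isBounded
  refine ⟨F 0, fun z h1 h2 => ?_⟩
  rw [← hD.apply_eq_apply_of_bounded hb z 0]
  simp [F, h1, h2]

/-- The period pair `(τ, 1)`. -/
def periodPair {τ : ℂ} (hτ : 0 < τ.im) : PeriodPair where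
  ω₁ := τ
  ω₂ := 1
  indep := by
    rw [LinearIndependent.pair_iff]
    intro s t h
    have h1 := congrArg im h
    have h2 := congrArg re h
    simp at h1 h2
    rcases h1 with rfl | h1
    · simpa using h2
    · exact absurd h1 hτ.ne'

lemma regSum_zero_eq_weierstrassP {τ : ℂ} (hτ : 0 < τ.im) (a : ℂ) :
    regSum 0 τ a = (periodPair hτ).weierstrassP a := by
  -- Evenness reconciles `ω + a` here with `z - ω` in the definition of `℘`.
  rw [← regSum_zero_neg hτ, regSum, PeriodPair.weierstrassP,
    ← (periodPair hτ).latticeEquivProd.symm.toEquiv.tsum_eq]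
  refine tsum_congr fun p => ?_
  have e : (((periodPair hτ).latticeEquivProd.symm p : (periodPair hτ).lattice) : ℂ) =
      point τ p := by
    rw [PeriodPair.latticeEquiv_symm_apply]
    simp [periodPair, point]
  simp only [LinearEquiv.coe_toEquiv, e, kernel_zero_left, one_div]
  congr 2
  ring

/-- Half-period translation on the square lattice, in terms of `regSum`. -/
lemma exists_regSum_half_period_mul {a : ℂ} (m n : ℤ) (h : 2 * a = m * I + n)
    (ha : ∀ m n : ℤ, a ≠ m * I + n) :
    ∃ c, ∀ z, (∀ m n : ℤ, z ≠ m * I + n) → (∀ m n : ℤ, z + a ≠ m * I + n) →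
      (regSum 0 I (z + a) - regSum 0 I a) * (regSum 0 I z - regSum 0 I a) = c := by
  have hI : 0 < I.im := by simp
  have hmem (z : ℂ) : z ∈ (periodPair hI).lattice ↔ ∃ m n : ℤ, z = m * I + n := by
    rw [PeriodPair.mem_lattice]
    simp [periodPair, eq_comm]
  obtain ⟨c, hc⟩ := exists_weierstrassP_half_period_mul (periodPair hI) (a := a)
    (by rw [hmem]; simpa using ha) (by rw [hmem]; exact ⟨m, n, h⟩)
  refine ⟨c, fun z h1 h2 => ?_⟩
  simp only [regSum_zero_eq_weierstrassP hI]
  exact hc z (by rw [hmem]; simpa using h1) (by rw [hmem]; simpa using h2)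

/-! ### The square lattice -/

lemma tendsto_shiftedSum_I (a : ℂ) :
    Tendsto (fun s => shiftedSum s I a) rightOfZero (𝓝 (regSum 0 I a)) := by
  have h := tendsto_shiftedSum_sub (τ := I) (by simp) a
  simpa only [shiftedSum_I, sub_zero] using h

lemma regSum_I_shift {a b : ℂ} (m n : ℤ) (h : b = a + (m * I + n)) :
    regSum 0 I b = regSum 0 I a := regSum_zero_shift (by simp) m n h

lemma regSum_I_shift_neg {a b : ℂ} (m n : ℤ) (h : b = -a + (m * I + n)) :
    regSum 0 I b = regSum 0 I a :=
  (regSum_I_shift m n h).trans (regSum_zero_neg (by simp) a)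

lemma regSum_I_mul_I (a : ℂ) : regSum 0 I (I * a) = -regSum 0 I a := by
  have h := regSum_zero_neg_inv (τ := I) (by simp) a
  rw [show -1 / I = I by simp, I_sq] at h
  linear_combination h

lemma regSum_I_half_I : regSum 0 I (I / 2) = -regSum 0 I (1 / 2) := by
  rw [← regSum_I_mul_I]
  ring_nf

lemma regSum_I_half_one_add_I : regSum 0 I ((1 + I) / 2) = 0 := by
  have h := regSum_I_mul_I ((1 + I) / 2)
  rw [regSum_I_shift (a := (1 + I) / 2) 0 (-1) (by push_cast; linear_combination I_sq / 2)] at h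
  exact self_eq_neg.mp h

lemma conj_regSum_I (a : ℂ) :
    (starRingEnd ℂ) (regSum 0 I a) = regSum 0 I ((starRingEnd ℂ) a) := by
  rw [regSum, conj_tsum, regSum, ← ((Equiv.neg ℤ).prodCongr (Equiv.refl ℤ)).tsum_eq]
  refine tsum_congr fun p => ?_
  simp [kernel_zero_left, point]

lemma regSum_I_ofReal (x : ℝ) : ∃ y : ℝ, regSum 0 I x = y := by
  have h := conj_regSum_I x
  rw [conj_ofReal] at h
  exact ⟨_, (conj_eq_iff_re.mp h).symm⟩

lemma jacobiTheta_I_ne_zero : jacobiTheta I ≠ 0 := by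
  intro h
  have h1 := norm_jacobiTheta_sub_one_le (τ := I) (by simp)
  rw [h] at h1
  simp only [zero_sub, norm_neg, norm_one, I_im, mul_one] at h1
  have h2 : Real.exp (-Real.pi) ≤ 1 / 4 := by
    have h3 : Real.exp (-Real.pi) ≤ Real.exp (-3) :=
      Real.exp_le_exp.mpr (by linarith [Real.pi_gt_three])
    have h4 : (4 : ℝ) ≤ Real.exp 3 := by linarith [Real.add_one_le_exp (3 : ℝ)]
    rw [Real.exp_neg 3] at h3
    exact h3.trans (by rw [one_div]; exact inv_anti₀ (by norm_num) h4)
  have h5 : 1 - Real.exp (-Real.pi) ≥ 3 / 4 := by linarith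
  have h6 : 2 / (1 - Real.exp (-Real.pi)) * Real.exp (-Real.pi) ≤ 2 / (3 / 4) * (1 / 4) := by
    gcongr
  norm_num at h6
  linarith

/-- Jacobi's identity at `1 + i` reads `2 ℘(1/2) = π² θ(i)⁴`. -/
lemma regSum_I_half_ne_zero : regSum 0 I (1 / 2) ≠ 0 := by
  have hI : 0 < (I + 1).im := by simp
  have h := regSum_zero_sub_eq_theta4 hI
  have e (a : ℂ) := regSum_zero_add_int (τ := I) (by simp) a 1
  simp only [Int.cast_one] at e
  rw [theta4_add_one, e, e, regSum_I_shift (a := I / 2) (b := (1 + (I + 1)) / 2) 0 1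
    (by push_cast; ring), regSum_I_half_I] at h
  intro h0
  rw [h0] at h
  have : (Real.pi : ℂ) ^ 2 * jacobiTheta I ^ 4 ≠ 0 :=
    mul_ne_zero (pow_ne_zero 2 (by exact_mod_cast Real.pi_ne_zero))
      (pow_ne_zero 4 jacobiTheta_I_ne_zero)
  exact this (by rw [← h]; ring)

lemma ne_gaussian_of_re {z : ℂ} (d k : ℤ) (hd : ¬ d ∣ k) (h : d * z.re = k) (m n : ℤ) :
    z ≠ m * I + n := by
  rintro rfl
  simp at h
  exact hd ⟨n, by exact_mod_cast h.symm⟩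

lemma ne_gaussian_of_im {z : ℂ} (d k : ℤ) (hd : ¬ d ∣ k) (h : d * z.im = k) (m n : ℤ) :
    z ≠ m * I + n := by
  rintro rfl
  simp at h
  exact hd ⟨m, by exact_mod_cast h.symm⟩

/-- The constant for `a = 1/2` is compared at `z = 1/3` and at `z = (1 + i)/2`, where `℘(z) = 0` and
`℘(z + a) = -℘(1/2)`. -/
lemma regSum_I_third_half :
    (regSum 0 I (1 / 6) - regSum 0 I (1 / 2)) * (regSum 0 I (1 / 3) - regSum 0 I (1 / 2)) =
      2 * regSum 0 I (1 / 2) ^ 2 := by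
  obtain ⟨c, hc⟩ := exists_regSum_half_period_mul (a := 1 / 2) 0 1 (by norm_num)
    (ne_gaussian_of_re 2 1 (by norm_num) (by norm_num))
  have h1 := hc (1 / 3) (ne_gaussian_of_re 3 1 (by norm_num) (by norm_num))
    (ne_gaussian_of_re 6 5 (by norm_num) (by norm_num))
  have h2 := hc ((1 + I) / 2) (ne_gaussian_of_im 2 1 (by norm_num) (by norm_num))
    (ne_gaussian_of_im 2 1 (by norm_num) (by norm_num))
  rw [regSum_I_shift_neg (a := 1 / 6) 0 1 (by push_cast; ring)] at h1
  rw [regSum_I_shift (a := I / 2) 0 1 (by push_cast; ring), regSum_I_half_I,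
    regSum_I_half_one_add_I] at h2
  linear_combination h1 - h2

lemma regSum_I_third_half_I :
    (regSum 0 I (1 / 3 + I / 2) + regSum 0 I (1 / 2)) *
      (regSum 0 I (1 / 3) + regSum 0 I (1 / 2)) = 2 * regSum 0 I (1 / 2) ^ 2 := by
  obtain ⟨c, hc⟩ := exists_regSum_half_period_mul (a := I / 2) 1 0 (by push_cast; ring)
    (ne_gaussian_of_im 2 1 (by norm_num) (by norm_num))
  have h1 := hc (1 / 3) (ne_gaussian_of_re 3 1 (by norm_num) (by norm_num))
    (ne_gaussian_of_re 3 1 (by norm_num) (by norm_num))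
  have h2 := hc ((1 + I) / 2) (ne_gaussian_of_im 2 1 (by norm_num) (by norm_num))
    (ne_gaussian_of_re 2 1 (by norm_num) (by norm_num))
  rw [regSum_I_half_I] at h1 h2
  rw [regSum_I_shift (a := 1 / 2) (b := (1 + I) / 2 + I / 2) 1 0 (by push_cast; ring),
    regSum_I_half_one_add_I] at h2
  linear_combination h1 - h2

lemma regSum_I_third_half_one_add_I :
    regSum 0 I (1 / 3 + (1 + I) / 2) * regSum 0 I (1 / 3) = -regSum 0 I (1 / 2) ^ 2 := by
  obtain ⟨c, hc⟩ := exists_regSum_half_period_mul (a := (1 + I) / 2) 1 1 (by push_cast; ring)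
    (ne_gaussian_of_im 2 1 (by norm_num) (by norm_num))
  have h1 := hc (1 / 3) (ne_gaussian_of_re 3 1 (by norm_num) (by norm_num))
    (ne_gaussian_of_im 2 1 (by norm_num) (by norm_num))
  have h2 := hc (1 / 2) (ne_gaussian_of_re 2 1 (by norm_num) (by norm_num))
    (ne_gaussian_of_im 2 1 (by norm_num) (by norm_num))
  rw [regSum_I_half_one_add_I] at h1 h2
  rw [regSum_I_shift (a := I / 2) 0 1 (by push_cast; ring), regSum_I_half_I] at h2
  linear_combination h1 - h2

/-- The unshifted series of `ℤ[i]` vanishes for all `s`, so the duplication formula passes to `℘`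
without correction; `2/3` and `5/6` are `-1/3` and `-1/6` modulo `1`. -/
lemma regSum_I_duplication :
    3 * regSum 0 I (1 / 3) = regSum 0 I (1 / 6) + regSum 0 I (1 / 3 + I / 2) +
      regSum 0 I (1 / 3 + (1 + I) / 2) := by
  have h1 := tendsto_shiftedSum_I (2 * (1 / 3))
  have h2 := (tendsto_kernel 2).mul ((((tendsto_shiftedSum_I (1 / 3)).add
    (tendsto_shiftedSum_I (1 / 3 + 1 / 2))).add (tendsto_shiftedSum_I (1 / 3 + I / 2))).add
    (tendsto_shiftedSum_I (1 / 3 + (1 + I) / 2)))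
  have h3 := tendsto_nhds_unique h1 (h2.congr' (eventually_rightOfZero.mono fun s hs =>
    (shiftedSum_two_mul (by simp) (1 / 3) hs).symm))
  rw [regSum_I_shift_neg (a := 1 / 3) (b := 2 * (1 / 3)) 0 1 (by push_cast; ring),
    regSum_I_shift_neg (a := 1 / 6) (b := 1 / 3 + 1 / 2) 0 1 (by push_cast; ring)] at h3
  linear_combination 4 * h3

/-- With `x = ℘(1/3)` and `e = ℘(1/2)`, eliminating the other values from the duplication formula
leaves `3x⁴ - 6x²e² - e⁴ = 0`, so `x² = (1 ± 2/√3) e²`. As `x` and `e` are real and `2/√3 > 1`, the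
sign is `+`. -/
lemma regSum_I_third_sq :
    regSum 0 I (1 / 3) ^ 2 =
      (1 + 2 / ((√3 : ℝ) : ℂ)) * regSum 0 I (1 / 2) ^ 2 := by
  have hu := regSum_I_third_half
  have hv := regSum_I_third_half_I
  have ht := regSum_I_third_half_one_add_I
  have hd := regSum_I_duplication
  have he := regSum_I_half_ne_zero
  obtain ⟨x, hx⟩ := regSum_I_ofReal (1 / 3)
  obtain ⟨e, he'⟩ := regSum_I_ofReal (1 / 2)
  push_cast at hx he'
  rw [hx, he'] at hu hv ⊢
  rw [hx] at hd
  rw [hx, he'] at ht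
  rw [he'] at he
  have h4 : (3 * x ^ 4 - 6 * x ^ 2 * e ^ 2 - e ^ 4 : ℂ) = 0 := by
    linear_combination (x * (x ^ 2 - e ^ 2)) * hd + x * (x + e) * hu + x * (x - e) * hv +
      (x ^ 2 - e ^ 2) * ht
  have h5 : 3 * x ^ 4 - 6 * x ^ 2 * e ^ 2 - e ^ 4 = 0 := by exact_mod_cast h4
  have he0 : e ≠ 0 := by exact_mod_cast he
  have hs : √3 ^ 2 = 3 := Real.sq_sqrt (by norm_num)
  have hs0 : 0 < √3 := by positivity
  have h6 : (√3 * x ^ 2 - (√3 + 2) * e ^ 2) * (√3 * x ^ 2 + (2 - √3) * e ^ 2) = 0 := by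
    linear_combination h5 + (x ^ 4 - 2 * x ^ 2 * e ^ 2 + e ^ 4) * hs
  have h7 : 0 < √3 * x ^ 2 + (2 - √3) * e ^ 2 := by
    have : √3 < 2 := by nlinarith
    have : 0 < 2 - √3 := by linarith
    positivity
  have h8 := (mul_eq_zero.mp h6).resolve_right h7.ne'
  have h9 : x ^ 2 = (1 + 2 / √3) * e ^ 2 := by
    field_simp
    linear_combination h8
  exact_mod_cast h9

lemma G2star_two_I : G2star (2 * I) = regSum 0 I (1 / 2) / 8 := by
  have h1 := tendsto_shiftedSum_zero (τ := 2 * I) (by simp)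
  have h2 := (tendsto_kernel 2).mul (tendsto_shiftedSum_I (1 / 2))
  have h3 := tendsto_nhds_unique h1 (h2.congr' (eventually_rightOfZero.mono fun s hs => by
    have h := shiftedSum_nat_mul 2 (τ := I) (by simp) 0 hs
    simp only [Fin.sum_univ_two, Fin.val_zero, Fin.val_one, Nat.cast_zero, Nat.cast_one,
      Nat.cast_ofNat, add_zero, zero_div, shiftedSum_I, zero_add] at h
    exact h.symm))
  linear_combination h3 / 2

lemma G2star_six_I : G2star (6 * I) =
    (2 * regSum 0 I (1 / 6) + 2 * regSum 0 I (1 / 3) + regSum 0 I (1 / 2)) / 72 := by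
  have h1 := tendsto_shiftedSum_zero (τ := 6 * I) (by simp)
  have h2 := (tendsto_kernel 6).mul (tendsto_finsetSum (Finset.univ : Finset (Fin 6))
    fun j _ => tendsto_shiftedSum_I (((j : ℕ) + 0) / (6 : ℕ)))
  have h3 := tendsto_nhds_unique h1 (h2.congr' (eventually_rightOfZero.mono fun s hs => by
    have h := shiftedSum_nat_mul 6 (τ := I) (by simp) 0 hs
    exact h.symm))
  have h0 : regSum 0 I 0 = 0 := by simp [regSum]
  simp only [Fin.sum_univ_six, Fin.isValue, Fin.coe_ofNat_eq_mod] at h3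
  norm_num [h0] at h3
  rw [regSum_I_shift_neg (a := 1 / 6) (b := 5 / 6) 0 1 (by push_cast; ring),
    regSum_I_shift_neg (a := 1 / 3) (b := 2 / 3) 0 1 (by push_cast; ring)] at h3
  linear_combination h3 / 2

lemma G2star_two_I_div_three : G2star (2 * I / 3) =
    (regSum 0 I (1 / 2) - 2 * regSum 0 I (1 / 3) - 2 * regSum 0 I (1 / 3 + I / 2)) / 8 := by
  have h2I : 0 < (2 * I).im := by simp
  have hS (a : ℂ) : Tendsto (fun s => shiftedSum s (2 * I) a) rightOfZero
      (𝓝 ((2 ^ 2)⁻¹ * (regSum 0 I (a / 2) + regSum 0 I ((1 + a) / 2)))) := by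
    refine ((tendsto_kernel 2).mul ((tendsto_shiftedSum_I _).add
      (tendsto_shiftedSum_I _))).congr' (eventually_rightOfZero.mono fun s hs => ?_)
    have h := shiftedSum_nat_mul 2 (τ := I) (by simp) a hs
    simp only [Fin.sum_univ_two, Fin.val_zero, Fin.val_one, Nat.cast_zero, Nat.cast_one,
      Nat.cast_ofNat, zero_add] at h
    exact h.symm
  have h1 := tendsto_shiftedSum_zero (τ := 2 * I / 3) (by simp)
  have h2 := ((hS 0).add (hS (2 * I / 3))).add (hS (2 * (2 * I) / 3))
  have h3 := tendsto_nhds_unique h1 (h2.congr' (eventually_rightOfZero.mono fun s hs =>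
    (shiftedSum_div_three h2I hs).symm))
  have h0 : regSum 0 I (0 / 2) = 0 := by simp [regSum]
  have e1 : regSum 0 I (2 * I / 3 / 2) = -regSum 0 I (1 / 3) := by
    rw [← regSum_I_mul_I]
    ring_nf
  have e2 : regSum 0 I ((1 + 2 * I / 3) / 2) = -regSum 0 I (1 / 3 + I / 2) := by
    rw [← regSum_I_mul_I]
    exact regSum_I_shift 0 1 (by push_cast; linear_combination -I_sq / 2)
  have e3 : regSum 0 I (2 * (2 * I) / 3 / 2) = -regSum 0 I (1 / 3) := by
    rw [← e1]
    exact regSum_I_shift_neg 1 0 (by push_cast; ring)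
  have e4 : regSum 0 I ((1 + 2 * (2 * I) / 3) / 2) = -regSum 0 I (1 / 3 + I / 2) := by
    rw [← e2]
    exact regSum_I_shift_neg 1 1 (by push_cast; ring)
  rw [h0, e1, e2, e3, e4, add_zero] at h3
  linear_combination h3 / 2

/-- In the notation of the proof the claim is `u - v - 2e = 2√3 e`. The half-period relations give
`(u - v - 2e)(x² - e²) = 4e³`, and `x² - e² = 2e²/√3`. -/
theorem G2level_two_combination_eq :
    -(2 / 3) * G2level 2 I + G2level 2 (3 * I) + 1 / 9 * G2level 2 (I / 3) =
      4 / (3 * ((√3 : ℝ) : ℂ)) * G2level 2 I := by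
  rw [G2level_two_combination, G2level, G2star_I, Nat.cast_ofNat, G2star_six_I,
    G2star_two_I_div_three, G2star_two_I]
  have hu := regSum_I_third_half
  have hv := regSum_I_third_half_I
  have hx := regSum_I_third_sq
  have he := regSum_I_half_ne_zero
  set e := regSum 0 I (1 / 2)
  set x := regSum 0 I (1 / 3)
  set u := regSum 0 I (1 / 6)
  set v := regSum 0 I (1 / 3 + I / 2)
  have hs0 : ((√3 : ℝ) : ℂ) ≠ 0 := by simp
  have hs : ((√3 : ℝ) : ℂ) ^ 2 = 3 := by
    rw [← ofReal_pow, Real.sq_sqrt (by norm_num)]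
    norm_num
  set r := ((√3 : ℝ) : ℂ)
  have hx' : r * (x ^ 2 - e ^ 2) = 2 * e ^ 2 := by
    rw [hx]
    field_simp
    ring
  have hne : x ^ 2 - e ^ 2 ≠ 0 := by
    intro h
    rw [h, mul_zero] at hx'
    exact he (by simpa using hx'.symm)
  have h1 : (u - v - 2 * e) * (x ^ 2 - e ^ 2) = 4 * e ^ 3 := by
    linear_combination (x + e) * hu - (x - e) * hv
  have h2 : u - v = 2 * e + 2 * r * e := by
    have : (u - v - 2 * e - 2 * r * e) * (x ^ 2 - e ^ 2) = 0 := by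
      linear_combination h1 - 2 * e * hx'
    linear_combination (mul_eq_zero.mp this).resolve_right hne
  field_simp
  linear_combination (864 * r) * h2 + 1728 * e * hs

end CMForms

end

theorem mainTheorem3 :
    (∀ τ : ℂ, 0 < τ.im →
      Filter.Tendsto (fun s => CMForms.eisensteinG 2 s τ) CMForms.rightOfZero
        (nhds (CMForms.G2star τ))) ∧
    CMForms.HasLValue CMForms.f27 2 (1 / 3 * CMForms.G2level 3 CMForms.zeta3) ∧
    CMForms.HasLValue CMForms.f32 2
      ((Real.pi : ℂ) ^ 2 / 8 * CMForms.theta4 (Complex.I * (√2 : ℝ)) ^ 4) ∧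
    CMForms.HasLValue CMForms.f48 2
      ((Real.pi : ℂ) ^ 2 / 8 * CMForms.theta4 (2 * CMForms.zeta3) ^ 4) ∧
    CMForms.HasLValue CMForms.f64 2
      ((Real.pi : ℂ) ^ 2 / 8 * CMForms.theta4 (2 * Complex.I) ^ 4) ∧
    (CMForms.HasLValue CMForms.f112 2
        (1 / 4 * CMForms.G2level 4 (Complex.I * (√7 : ℝ) / 2)) ∧
      1 / 4 * CMForms.G2level 4 (Complex.I * (√7 : ℝ) / 2) =
        (Real.pi : ℂ) ^ 2 / 8 * CMForms.theta4 (1 + Complex.I * (√7 : ℝ)) ^ 4) ∧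
    (CMForms.HasLValue CMForms.f144 2
        (-(2 / 3) * CMForms.G2level 2 Complex.I + CMForms.G2level 2 (3 * Complex.I) +
          1 / 9 * CMForms.G2level 2 (Complex.I / 3)) ∧
      -(2 / 3) * CMForms.G2level 2 Complex.I + CMForms.G2level 2 (3 * Complex.I) +
          1 / 9 * CMForms.G2level 2 (Complex.I / 3) =
        4 / (3 * ((√3 : ℝ) : ℂ)) * CMForms.G2level 2 Complex.I) := by
  have hI : 0 < (Complex.I * (√7 : ℝ)).im := by simp
  have h4 := CMForms.G2level_four_eq hI
  have h144 := CMForms.hasLValue_f144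
  rw [← CMForms.G2level_two_combination] at h144
  exact ⟨fun _ => CMForms.tendsto_eisensteinG, CMForms.hasLValue_f27, CMForms.hasLValue_f32,
    CMForms.hasLValue_f48, CMForms.hasLValue_f64, ⟨h4 ▸ CMForms.hasLValue_f112, h4⟩,
    h144, CMForms.G2level_two_combination_eq⟩
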